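/- A word automaton is a nondeterministic finite automaton reading finite words over a finite alphabet $\Sigma$. The convolution of $x,y\in\Sigma^\star$ is the word over $(\Sigma\cup\{\Diamond\})^2$ obtained by reading $x$ and $y$ in parallel, where the shorter word is padded at its end with the new symbol $\Diamond$. A pair consisting of a word automaton $\mathcal M$ over $\Sigma$ and a word automaton $\mathcal M_\le$ over $(\Sigma\cup\{\Diamond\})^2$ presents the structure $(A;\le)$ whose domain $A\subseteq\Sigma^\star$ is the language of $\mathcal M$ and in which, for $x,y\in A$, $x\le y$ holds if and only if $\mathcal M_\le$ accepts the convolution of $x$ and $y$. A linear order is called an ordinal if it is well-founded; it is an automatic ordinal if it is presented by such a pair. Theorem. The isomorphism problem for automatic ordinals is decidable: there is an algorithm which, given two pairs $(\mathcal M,\mathcal M_\le)$ and $(\mathcal N,\mathcal N_\le)$ of word automata, each pair over some finite alphabet, decides whether the two presented structures are both ordinals and are isomorphic. In particular, the algorithm decides whether two given automatic ordinals are isomorphic. -/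

import Mathlib

/-- A finite description of a nondeterministic word automaton. The states are the numbers below
`numStates`, `start` is the initial state, `trans` lists the transition table as triples
(state, letter, state), and `accept` lists the accepting states. Letters are written in `β`. -/
structure WordAutomaton (β : Type) where
  numStates : ℕ
  start : ℕ
  trans : List (ℕ × β × ℕ)
  accept : List ℕ

namespace WordAutomaton

def equivProd (β : Type) :
    WordAutomaton β ≃ ℕ × ℕ × List (ℕ × β × ℕ) × List ℕ where
  toFun A := (A.numStates, A.start, A.trans, A.accept)
  invFun p := ⟨p.1, p.2.1, p.2.2.1, p.2.2.2⟩
  left_inv _ := rfl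
  right_inv _ := rfl

instance instPrimcodable (β : Type) [Primcodable β] : Primcodable (WordAutomaton β) :=
  Primcodable.ofEquiv _ (equivProd β)

/-- The automaton over the alphabet `α` that is described by `A`, when the letter `a` is written
as `code a`. Entries of the lists that mention other letters or numbers that are not states
have no effect, and an automaton whose `start` is not a state accepts nothing. -/
def toNFA {α β : Type} (A : WordAutomaton β) (code : α → β) : NFA α (Fin A.numStates) where
  step q a := {r | ((q : ℕ), code a, (r : ℕ)) ∈ A.trans}
  start := {q | (q : ℕ) = A.start}
  accept := {q | (q : ℕ) ∈ A.accept}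

end WordAutomaton

/-- The convolution of two words: they are read in parallel, and the shorter one is padded at its
end with the new symbol `none`. -/
def wordConvolution {α : Type} (x y : List α) : List (Option α × Option α) :=
  List.zipWithAll Prod.mk x y

/-- A finite description of a word-automatic structure with one binary relation: the size of the
alphabet, an automaton for the domain, and an automaton that reads convolutions of pairs of
words, for the relation. -/
structure AutomaticPresentation where
  alphabetSize : ℕ
  domain : WordAutomaton ℕ
  relation : WordAutomaton (Option ℕ × Option ℕ)

namespace AutomaticPresentation

def equivProd :
    AutomaticPresentation ≃ ℕ × WordAutomaton ℕ × WordAutomaton (Option ℕ × Option ℕ) where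
  toFun P := (P.alphabetSize, P.domain, P.relation)
  invFun p := ⟨p.1, p.2.1, p.2.2⟩
  left_inv _ := rfl
  right_inv _ := rfl

instance instPrimcodable : Primcodable AutomaticPresentation :=
  Primcodable.ofEquiv _ equivProd

/-- The regular language over the alphabet `{0, …, k - 1}` accepted by the domain automaton. -/
def domainLanguage (P : AutomaticPresentation) : Language (Fin P.alphabetSize) :=
  (P.domain.toNFA Fin.val).accepts

/-- The regular language of convolutions accepted by the automaton of the relation. -/
def relationLanguage (P : AutomaticPresentation) :
    Language (Option (Fin P.alphabetSize) × Option (Fin P.alphabetSize)) :=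
  (P.relation.toNFA fun a => (a.1.map Fin.val, a.2.map Fin.val)).accepts

/-- The domain of the presented structure. -/
def Carrier (P : AutomaticPresentation) : Type :=
  {w : List (Fin P.alphabetSize) // w ∈ P.domainLanguage}

/-- The binary relation of the presented structure. -/
def Le (P : AutomaticPresentation) (x y : P.Carrier) : Prop :=
  wordConvolution x.1 y.1 ∈ P.relationLanguage

/-- The presented structure is an ordinal: its relation is a (reflexive) linear order which is
well-founded. -/
def IsOrdinal (P : AutomaticPresentation) : Prop :=
  IsLinearOrder P.Carrier P.Le ∧ WellFounded fun x y : P.Carrier => P.Le x y ∧ x ≠ y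

/-- The presented structures are isomorphic. -/
def Isomorphic (P Q : AutomaticPresentation) : Prop :=
  Nonempty (P.Le ≃r Q.Le)

end AutomaticPresentation

/-! The derivative of a linear order keeps the points that have no other point at finite distance
below them; in an ordinal these are 0 and the limits. Three facts reduce the theorem to finitely
many iterated derivatives.

Rank bound (Delhommé). Cut an initial segment according to the prefixes of a fixed length. Some
class is as large, on the scale of powers of ω, as the segment itself. Prefixes and bounds with the
same automaton classes give isomorphic pieces, so only boundedly many powers of ω occur
(`not_isLarge_initial`). Hence derivative number `J` of an automatic ordinal has at most one point,
for every `J` above a bound computed from the automata (`subsingleton_iterDeriv`).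

Well-foundedness. A linear order is well-founded if derivative number `J` has at most one point and,
at each earlier level, every point lies finitely far above a point of the next level
(`wellFoundedLT_of_derivCofinite`).

Isomorphism. Two such ordinals are isomorphic as soon as they agree on being empty and on the
number, possibly infinite, of points of each level `j < J` above all of level `j + 1`
(`nonempty_orderIso_iff`). These numbers play the role of the coefficients of the Cantor normal
form.

All these conditions arise from regular relations by Boolean operations, "there is" and "there are
infinitely many". These operations preserve finite Myhill-Nerode index with computable bounds. No
automaton for a derivative is ever built: by pumping, an index bound turns each quantifier into a
search among words of bounded length, and that search is primitive recursive. -/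

/-- Replace everything after position `t` in the words that are at least that long. -/
def splice {ι α : Type} (t : ℕ) (x y : ι → List α) : ι → List α :=
  fun i => if t ≤ (x i).length then (x i).take t ++ y i else x i

/-- The relation `R` on words is recognized, reading all words in parallel, with at most `N`
Myhill-Nerode classes. -/
def HasIndex {ι α : Type} (N : ℕ) (R : (ι → List α) → Prop) : Prop :=
  ∃ (S : Type) (_ : Fintype S) (f : ℕ → (ι → List α) → S), Fintype.card S ≤ N ∧
    ∀ t x t' x', f t x = f t' x' → ∀ y, R (splice t x y) ↔ R (splice t' x' y)

/-! ### Relations of finite index: closure properties and pumping -/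

namespace HasIndex

variable {ι α : Type} {N M : ℕ} {R Q : (ι → List α) → Prop}

theorem mono (h : HasIndex N R) (hNM : N ≤ M) : HasIndex M R := by
  obtain ⟨S, _, f, hc, hf⟩ := h
  exact ⟨S, _, f, hc.trans hNM, hf⟩

theorem congr (h : HasIndex N R) (hRQ : ∀ x, R x ↔ Q x) : HasIndex N Q := by
  obtain rfl : R = Q := funext fun x => propext (hRQ x)
  exact h

theorem not (h : HasIndex N R) : HasIndex N fun x => ¬ R x := by
  obtain ⟨S, _, f, hc, hf⟩ := h
  exact ⟨S, _, f, hc, fun t x t' x' e y => not_congr (hf t x t' x' e y)⟩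

theorem and (h : HasIndex N R) (h' : HasIndex M Q) : HasIndex (N * M) fun x => R x ∧ Q x := by
  obtain ⟨S, _, f, hc, hf⟩ := h
  obtain ⟨T, _, g, hd, hg⟩ := h'
  refine ⟨S × T, inferInstance, fun t x => (f t x, g t x), ?_, fun t x t' x' e y => ?_⟩
  · rw [Fintype.card_prod]
    exact Nat.mul_le_mul hc hd
  · rw [Prod.mk.injEq] at e
    exact and_congr (hf _ _ _ _ e.1 y) (hg _ _ _ _ e.2 y)

theorem reindex (h : HasIndex N R) {κ : Type} (σ : ι → κ) :
    HasIndex N fun x : κ → List α => R fun i => x (σ i) := by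
  obtain ⟨S, _, f, hc, hf⟩ := h
  exact ⟨S, _, fun t x => f t fun i => x (σ i), hc,
    fun t x t' x' e y => hf _ _ _ _ e fun i => y (σ i)⟩

theorem exists_state_eq (h : HasIndex N R) (L : ℕ) (x : ι → List α) :
    ∃ a b, L ≤ a ∧ a < b ∧ b ≤ L + N ∧ ∀ y, R (splice a x y) ↔ R (splice b x y) := by
  obtain ⟨S, _, f, hc, hf⟩ := h
  obtain ⟨a, b, hab, e⟩ := Fintype.exists_ne_map_eq_of_card_lt
    (fun k : Fin (N + 1) => f (L + k) x) (by simpa using Nat.lt_succ_of_le hc)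
  rcases lt_or_gt_of_ne hab with hlt | hlt
  · exact ⟨L + a, L + b, by omega, by simpa using hlt, by omega, hf _ _ _ _ e⟩
  · exact ⟨L + b, L + a, by omega, by simpa using hlt, by omega, hf _ _ _ _ e.symm⟩

/-- The letters between two positions in the same class can be deleted from all words at once. Words
of length at most `a` are unaffected. -/
theorem cut (h : HasIndex N R) (L : ℕ) (x : ι → List α) (hx : R x) :
    ∃ a b, L ≤ a ∧ a < b ∧ b ≤ L + N ∧ R fun i => (x i).take a ++ (x i).drop b := by
  obtain ⟨a, b, hL, hab, hb, H⟩ := h.exists_state_eq L x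
  refine ⟨a, b, hL, hab, hb, ?_⟩
  have h1 : splice b x (fun i => (x i).drop b) = x := by funext i; simp [splice]
  have h2 : splice a x (fun i => (x i).drop b) = fun i => (x i).take a ++ (x i).drop b := by
    funext i
    by_cases hi : a ≤ (x i).length
    · simp [splice, hi]
    · have : (x i).length ≤ a := by omega
      simp [splice, hi, List.take_of_length_le this, List.drop_of_length_le (this.trans hab.le)]
  rwa [← h2, H, h1]

/-- A satisfiable relation has a short witness, which keeps the words that are already short. -/
theorem exists_short [Fintype ι] (h : HasIndex N R) (L : ℕ) (x : ι → List α) (hx : R x) :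
    ∃ x', R x' ∧ (∀ i, (x i).length ≤ L → x' i = x i) ∧ ∀ i, (x' i).length ≤ L + N := by
  induction hs : ∑ i, (x i).length using Nat.strong_induction_on generalizing x with
  | _ s ih =>
    by_cases hlong : ∀ i, (x i).length ≤ L + N
    · exact ⟨x, hx, fun _ _ => rfl, hlong⟩
    push Not at hlong
    obtain ⟨i, hi⟩ := hlong
    obtain ⟨a, b, hL, hab, hb, hR⟩ := h.cut L x hx
    have hle : ∀ j, ((x j).take a ++ (x j).drop b).length ≤ (x j).length := by
      intro j; simp; omega
    obtain ⟨x', hx', hsh, hl⟩ := ih _ (by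
      rw [← hs]
      exact Finset.sum_lt_sum (fun j _ => hle j) ⟨i, Finset.mem_univ _, by simp; omega⟩) _ hR rfl
    refine ⟨x', hx', fun j hj => ?_, hl⟩
    rw [hsh j ((hle j).trans hj), List.take_of_length_le (hj.trans hL),
      List.drop_of_length_le (by omega), List.append_nil]

variable [DecidableEq ι]

theorem splice_update (t : ℕ) (x y : ι → List α) (i : ι) (v w : List α) :
    splice t (Function.update x i v) (Function.update y i w) =
      Function.update (splice t x y) i (if t ≤ v.length then v.take t ++ w else v) := by
  funext j
  by_cases h : j = i
  · subst h; simp [splice]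
  · simp [splice, h]

theorem splice_update_drop (t : ℕ) (x y : ι → List α) (i : ι) (w : List α) :
    splice t (Function.update x i w) (Function.update y i (w.drop t)) =
      Function.update (splice t x y) i w := by
  rw [splice_update]; simp

theorem card_set_le {S : Type} [Fintype S] (hc : Fintype.card S ≤ N) :
    Fintype.card (Set S) ≤ 2 ^ N := by
  rw [Fintype.card_set]
  exact Nat.pow_le_pow_right two_pos hc

/-- The subset construction: the new class is the set of old classes over all choices of the
quantified word. A witness is transferred by keeping a prefix in the same class and appending the
rest of the old witness. -/
theorem ex (h : HasIndex N R) (i : ι) :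
    HasIndex (2 ^ N) fun x => ∃ w, R (Function.update x i w) := by
  obtain ⟨S, _, f, hc, hf⟩ := h
  classical
  have key : ∀ t x t' x', (Set.range fun w => f t (Function.update x i w)) =
      (Set.range fun w => f t' (Function.update x' i w)) →
      ∀ y, (∃ w, R (Function.update (splice t x y) i w)) →
        ∃ w, R (Function.update (splice t' x' y) i w) := by
    rintro t x t' x' e y ⟨w, hw⟩
    obtain ⟨q, hq⟩ : f t (Function.update x i w) ∈
        Set.range fun w => f t' (Function.update x' i w) := e ▸ Set.mem_range_self w
    rw [← splice_update_drop, ← hf _ _ _ _ hq, splice_update] at hw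
    exact ⟨_, hw⟩
  exact ⟨Set S, inferInstance, fun t x => Set.range fun w => f t (Function.update x i w),
    card_set_le hc, fun t x t' x' e y => ⟨key _ _ _ _ e y, key _ _ _ _ e.symm y⟩⟩

/-- As in `ex`, but only words that reach position `t` are counted. A witness of length at least `n
+ t` leaves at least `n` letters after position `t`, and these survive the exchange of prefixes. -/
theorem exUnbounded (h : HasIndex N R) (i : ι) :
    HasIndex (2 ^ N) fun x => ∀ n, ∃ w : List α, n ≤ w.length ∧ R (Function.update x i w) := by
  obtain ⟨S, _, f, hc, hf⟩ := h
  classical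
  let g : ℕ → (ι → List α) → Set S :=
    fun t x => {s | ∃ w : List α, t ≤ w.length ∧ f t (Function.update x i w) = s}
  have key : ∀ t x t' x', g t x = g t' x' →
      ∀ y, (∀ n, ∃ w : List α, n ≤ w.length ∧ R (Function.update (splice t x y) i w)) →
        ∀ n, ∃ w : List α, n ≤ w.length ∧ R (Function.update (splice t' x' y) i w) := by
    intro t x t' x' e y H n
    obtain ⟨w, hl, hw⟩ := H (n + t)
    obtain ⟨q, hql, hq⟩ : f t (Function.update x i w) ∈ g t' x' := e ▸ ⟨w, by omega, rfl⟩
    rw [← splice_update_drop, ← hf _ _ _ _ hq, splice_update, if_pos hql] at hw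
    exact ⟨_, by simp; omega, hw⟩
  exact ⟨Set S, inferInstance, g, card_set_le hc,
    fun t x t' x' e y => ⟨key _ _ _ _ e y, key _ _ _ _ e.symm y⟩⟩

theorem exists_short_update [Fintype ι] (h : HasIndex N R) {L : ℕ} {x : ι → List α} {i : ι}
    (hL : ∀ j, j ≠ i → (x j).length ≤ L) {w : List α} (hw : R (Function.update x i w)) :
    ∃ w' : List α, w'.length ≤ L + N ∧ R (Function.update x i w') := by
  obtain ⟨x', hR, hk, hl⟩ := h.exists_short L _ hw
  refine ⟨x' i, hl i, ?_⟩
  convert hR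
  funext j
  by_cases hj : j = i
  · subst hj; simp
  · simp only [ne_eq, hj, not_false_eq_true, Function.update_of_ne] at hk ⊢
    have := hk j
    simp only [ne_eq, hj, not_false_eq_true, Function.update_of_ne] at this
    exact (this (hL j hj)).symm

/-- A long witness can be pumped. -/
theorem exists_longer (h : HasIndex N R) {L : ℕ} {x : ι → List α} {i : ι}
    (hL : ∀ j, j ≠ i → (x j).length ≤ L) {w : List α} (hl : L + N < w.length)
    (hw : R (Function.update x i w)) :
    ∃ w' : List α, w.length < w'.length ∧ R (Function.update x i w') := by
  obtain ⟨a, b, hLa, hab, hb, H⟩ := h.exists_state_eq L (Function.update x i w)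
  have key : ∀ c v, L ≤ c → c ≤ w.length →
      splice c (Function.update x i w) (Function.update (fun _ => []) i v) =
        Function.update x i (w.take c ++ v) := by
    intro c v hc hcw
    rw [splice_update, if_pos hcw]
    funext j
    by_cases hj : j = i
    · subst hj; simp
    · have hjc : (x j).length ≤ c := (hL j hj).trans hc
      simp [splice, hj, List.take_of_length_le hjc]
  refine ⟨w.take b ++ w.drop a, by simp; omega, ?_⟩
  rw [← key b _ (by omega) (by omega), ← H, key a _ hLa (by omega)]
  simpa using hw

/-- A cut removes at most `N` letters, so a word longer than `L + 2 * N` stays longer than `L + N`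
and cutting cannot jump over the window. -/
theorem exists_long_short [Fintype ι] (h : HasIndex N R) {L : ℕ} {x : ι → List α} {i : ι}
    (hL : ∀ j, j ≠ i → (x j).length ≤ L) {w : List α} (hl : L + N < w.length)
    (hw : R (Function.update x i w)) :
    ∃ w' : List α, L + N < w'.length ∧ w'.length ≤ L + 2 * N ∧ R (Function.update x i w') := by
  induction hs : w.length using Nat.strong_induction_on generalizing w with
  | _ s ih =>
    by_cases hlong : w.length ≤ L + 2 * N
    · exact ⟨w, hl, hlong, hw⟩
    obtain ⟨a, b, hLa, hab, hb, hR⟩ := h.cut L _ hw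
    refine ih (w.take a ++ w.drop b).length ?_ (w := w.take a ++ w.drop b) ?_ ?_ rfl
    · simp; omega
    · simp; omega
    · convert hR using 1
      funext j
      by_cases hj : j = i
      · subst hj; simp
      · have := hL j hj
        simp [hj, List.take_of_length_le (this.trans hLa),
          List.drop_of_length_le (show (x j).length ≤ b by omega)]

/-- Witnesses are unboundedly long as soon as one of moderate length exists. -/
theorem unbounded_iff [Fintype ι] (h : HasIndex N R) {L : ℕ} {x : ι → List α} {i : ι}
    (hL : ∀ j, j ≠ i → (x j).length ≤ L) :
    (∀ n, ∃ w : List α, n ≤ w.length ∧ R (Function.update x i w)) ↔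
      ∃ w : List α, L + N < w.length ∧ w.length ≤ L + 2 * N ∧ R (Function.update x i w) := by
  constructor
  · intro H
    obtain ⟨w, hl, hw⟩ := H (L + N + 1)
    exact h.exists_long_short hL hl hw
  · rintro ⟨w, hl, -, hw⟩ n
    induction n with
    | zero => exact ⟨w, by omega, hw⟩
    | succ n ih =>
      obtain ⟨v, hn, hv⟩ := ih
      by_cases hv' : L + N < v.length
      · obtain ⟨u, hu, hR⟩ := h.exists_longer hL hv' hv
        exact ⟨u, by omega, hR⟩
      · obtain ⟨u, hu, hR⟩ := h.exists_longer hL hl hw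
        exact ⟨u, by omega, hR⟩

end HasIndex

/-! ### Derivatives and their transport along embeddings -/

/-- The points of `D` that are not preceded in `D` by another point at finite distance. -/
def ordDeriv {W : Type} (lt : W → W → Prop) (D : Set W) : Set W :=
  {x | x ∈ D ∧ ∀ y ∈ D, lt y x → {z | z ∈ D ∧ lt y z ∧ lt z x}.Infinite}

def iterDeriv {W : Type} (lt : W → W → Prop) (D : Set W) : ℕ → Set W
  | 0 => D
  | j + 1 => ordDeriv lt (iterDeriv lt D j)

/-- The points of `D` that are larger than all points of the derivative. -/
def derivTail {W : Type} (lt : W → W → Prop) (D : Set W) : Set W :=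
  {x | x ∈ D ∧ ∀ y ∈ ordDeriv lt D, lt y x}

/-- Every point of `D` is at finite distance above some point of the derivative. -/
def DerivCofinite {W : Type} (lt : W → W → Prop) (D : Set W) : Prop :=
  ∀ x ∈ D, ∃ y ∈ ordDeriv lt D, ¬ lt x y ∧ ¬ {z | z ∈ D ∧ lt y z ∧ lt z x}.Infinite

section Transport

variable {V W : Type} {ltV : V → V → Prop} {ltW : W → W → Prop}

theorem ordDeriv_subset (lt : W → W → Prop) (D : Set W) : ordDeriv lt D ⊆ D := fun _ h => h.1

theorem iterDeriv_subset (lt : W → W → Prop) (D : Set W) (j : ℕ) : iterDeriv lt D j ⊆ D := by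
  induction j with
  | zero => exact subset_rfl
  | succ j ih => exact (ordDeriv_subset _ _).trans ih

/-- The hypothesis `hD` covers two uses: `e` maps onto an initial segment, or `D` lies in the range
of `e`. Derivatives only look downwards, so the first is enough for them. -/
theorem infinite_between_iff {e : V → W} (he : Function.Injective e)
    (hlt : ∀ a b, ltW (e a) (e b) ↔ ltV a b) {D : Set W}
    (hD : ∀ b ∈ D, ∀ a, ltW b (e a) → b ∈ Set.range e) (x y : V) :
    {z | z ∈ D ∧ ltW (e y) z ∧ ltW z (e x)}.Infinite ↔
      {z | z ∈ e ⁻¹' D ∧ ltV y z ∧ ltV z x}.Infinite := by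
  have : {z | z ∈ D ∧ ltW (e y) z ∧ ltW z (e x)} =
      e '' {z | z ∈ e ⁻¹' D ∧ ltV y z ∧ ltV z x} := by
    ext z
    constructor
    · rintro ⟨h1, h2, h3⟩
      obtain ⟨z, rfl⟩ := hD z h1 x h3
      exact ⟨z, ⟨h1, (hlt _ _).1 h2, (hlt _ _).1 h3⟩, rfl⟩
    · rintro ⟨z, ⟨h1, h2, h3⟩, rfl⟩
      exact ⟨h1, (hlt _ _).2 h2, (hlt _ _).2 h3⟩
  rw [this, Set.infinite_image_iff he.injOn]

theorem preimage_ordDeriv {e : V → W} (he : Function.Injective e)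
    (hlt : ∀ a b, ltW (e a) (e b) ↔ ltV a b) {D : Set W}
    (hD : ∀ b ∈ D, ∀ a, ltW b (e a) → b ∈ Set.range e) :
    e ⁻¹' ordDeriv ltW D = ordDeriv ltV (e ⁻¹' D) := by
  ext x
  refine and_congr_right fun _ => ⟨fun H y hy hyx => ?_, fun H y hy hyx => ?_⟩
  · exact (infinite_between_iff he hlt hD x y).1 (H _ hy ((hlt _ _).2 hyx))
  · obtain ⟨y, rfl⟩ := hD y hy x hyx
    exact (infinite_between_iff he hlt hD x y).2 (H _ hy ((hlt _ _).1 hyx))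

theorem preimage_iterDeriv {e : V → W} (he : Function.Injective e)
    (hlt : ∀ a b, ltW (e a) (e b) ↔ ltV a b) {D : Set W}
    (hD : ∀ b ∈ D, ∀ a, ltW b (e a) → b ∈ Set.range e) (j : ℕ) :
    e ⁻¹' iterDeriv ltW D j = iterDeriv ltV (e ⁻¹' D) j := by
  induction j with
  | zero => rfl
  | succ j ih =>
    simp only [iterDeriv]
    rw [preimage_ordDeriv he hlt fun b hb => hD b (iterDeriv_subset _ _ _ hb), ih]

theorem derivCofinite_preimage_iff {e : V → W} (he : Function.Injective e)
    (hlt : ∀ a b, ltW (e a) (e b) ↔ ltV a b) {D : Set W} (hD : D ⊆ Set.range e) :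
    DerivCofinite ltV (e ⁻¹' D) ↔ DerivCofinite ltW D := by
  have hD' : ∀ b ∈ D, ∀ a, ltW b (e a) → b ∈ Set.range e := fun b hb _ _ => hD hb
  unfold DerivCofinite
  rw [← preimage_ordDeriv he hlt hD']
  constructor
  · intro H x hx
    obtain ⟨x, rfl⟩ := hD hx
    obtain ⟨y, hy, h1, h2⟩ := H x hx
    exact ⟨e y, hy, (hlt _ _).not.2 h1, (infinite_between_iff he hlt hD' x y).not.2 h2⟩
  · intro H x hx
    obtain ⟨y, hy, h1, h2⟩ := H (e x) hx
    obtain ⟨y, rfl⟩ := hD (ordDeriv_subset _ _ hy)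
    exact ⟨y, hy, (hlt _ _).not.1 h1, (infinite_between_iff he hlt hD' x y).not.1 h2⟩

theorem preimage_derivTail {e : V → W} (he : Function.Injective e)
    (hlt : ∀ a b, ltW (e a) (e b) ↔ ltV a b) {D : Set W} (hD : D ⊆ Set.range e) :
    e ⁻¹' derivTail ltW D = derivTail ltV (e ⁻¹' D) := by
  have hD' : ∀ b ∈ D, ∀ a, ltW b (e a) → b ∈ Set.range e := fun b hb _ _ => hD hb
  unfold derivTail
  rw [← preimage_ordDeriv he hlt hD']
  ext x
  refine and_congr_right fun _ => ⟨fun H y hy => (hlt _ _).1 (H _ hy), fun H y hy => ?_⟩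
  obtain ⟨y, rfl⟩ := hD (ordDeriv_subset _ _ hy)
  exact (hlt _ _).2 (H _ hy)

end Transport

/-! ### Sets of order type at least a power of ω -/

section Large

variable {V W : Type}

/-- `X` contains `n` consecutive pieces that satisfy `P`. -/
def HasPieces (lt : W → W → Prop) (P : Set W → Prop) : ℕ → Set W → Prop
  | 0, _ => True
  | n + 1, X => ∃ A B, A ⊆ X ∧ B ⊆ X ∧ (∀ a ∈ A, ∀ b ∈ B, lt a b) ∧ P A ∧ HasPieces lt P n B

/-- For a well-ordered `X` this says that the order type of `X` is at least `ω ^ j`. -/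
def IsLarge (lt : W → W → Prop) : ℕ → Set W → Prop
  | 0, X => X.Nonempty
  | j + 1, X => ∀ n, HasPieces lt (IsLarge lt j) n X

variable {lt : W → W → Prop} {X Y : Set W} {j : ℕ}

theorem HasPieces.mono {P : Set W → Prop} {n : ℕ} (h : HasPieces lt P n X) (hXY : X ⊆ Y) :
    HasPieces lt P n Y := by
  cases n with
  | zero => trivial
  | succ n =>
    obtain ⟨A, B, hA, hB, h⟩ := h
    exact ⟨A, B, hA.trans hXY, hB.trans hXY, h⟩

theorem IsLarge.mono (h : IsLarge lt j X) (hXY : X ⊆ Y) : IsLarge lt j Y := by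
  cases j with
  | zero => exact Set.Nonempty.mono hXY h
  | succ j => exact fun n => (h n).mono hXY

theorem IsLarge.of_succ (h : IsLarge lt (j + 1) X) : IsLarge lt j X := by
  obtain ⟨A, B, hA, -, -, hl, -⟩ := h 1
  exact hl.mono hA

theorem IsLarge.of_le {i : ℕ} (h : IsLarge lt j X) (hij : i ≤ j) : IsLarge lt i X := by
  induction hij with
  | refl => exact h
  | step _ ih => exact ih h.of_succ

theorem IsLarge.exists_split (h : IsLarge lt (j + 1) X) :
    ∃ A ⊆ X, IsLarge lt j A ∧ ∃ b ∈ X, ∀ a ∈ A, lt a b := by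
  obtain ⟨A, B, hA, hB, hAB, hl, A', B', hA', -, -, hl', -⟩ := h 2
  obtain ⟨b, hb⟩ := hl'.of_le (Nat.zero_le j)
  exact ⟨A, hA, hl, b, hB (hA' hb), fun a ha => hAB a ha b (hA' hb)⟩

/-- Each piece of `Z` has a part satisfying `P` in `X` or in `Y` and is credited to that side. Of `a
+ b` pieces, either `a` go to `X` or `b` go to `Y`. -/
theorem HasPieces.union {P : Set W → Prop} (hP : ∀ X Y, P (X ∪ Y) → P X ∨ P Y) (n : ℕ) :
    ∀ (a b : ℕ) (X Y Z : Set W), Z ⊆ X ∪ Y → a + b = n → HasPieces lt P n Z →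
      HasPieces lt P a X ∨ HasPieces lt P b Y := by
  induction n with
  | zero =>
    intro a b X Y Z _ hab _
    obtain rfl : a = 0 := by omega
    exact Or.inl trivial
  | succ n ih =>
    rintro a b X Y Z hZ hab ⟨A, B, hA, hB, hAB, hPA, hn⟩
    have hAeq : A = (A ∩ X) ∪ (A ∩ Y) := by
      rw [← Set.inter_union_distrib_left, Set.inter_eq_left.2 (hA.trans hZ)]
    have hBeq : B ⊆ (B ∩ X) ∪ (B ∩ Y) := by
      rw [← Set.inter_union_distrib_left, Set.inter_eq_left.2 (hB.trans hZ)]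
    rw [hAeq] at hPA
    rcases hP _ _ hPA with h | h
    · cases a with
      | zero => exact Or.inl trivial
      | succ a =>
        rcases ih a b _ _ B hBeq (by omega) hn with h' | h'
        · exact Or.inl ⟨_, _, Set.inter_subset_right, Set.inter_subset_right,
            fun x hx y hy => hAB x hx.1 y hy.1, h, h'⟩
        · exact Or.inr (h'.mono Set.inter_subset_right)
    · cases b with
      | zero => exact Or.inr trivial
      | succ b =>
        rcases ih a b _ _ B hBeq (by omega) hn with h' | h'
        · exact Or.inl (h'.mono Set.inter_subset_right)
        · exact Or.inr ⟨_, _, Set.inter_subset_right, Set.inter_subset_right,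
            fun x hx y hy => hAB x hx.1 y hy.1, h, h'⟩

/-- Indivisibility of `ω ^ j`: if `X` does not have `a` pieces and `Y` does not have `b`, the union
does not have `a + b`. -/
theorem IsLarge.union (j : ℕ) :
    ∀ X Y : Set W, IsLarge lt j (X ∪ Y) → IsLarge lt j X ∨ IsLarge lt j Y := by
  induction j with
  | zero => exact fun X Y h => Set.union_nonempty.1 h
  | succ j ih =>
    intro X Y h
    by_contra! hc
    obtain ⟨hX, hY⟩ := hc
    simp only [IsLarge, not_forall] at hX hY
    obtain ⟨a, ha⟩ := hX
    obtain ⟨b, hb⟩ := hY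
    exact (HasPieces.union ih (a + b) a b X Y _ subset_rfl rfl (h _)).elim ha hb

theorem IsLarge.exists_of_biUnion {κ : Type} {s : Set κ} (hs : s.Finite) {F : κ → Set W}
    (h : IsLarge lt j (⋃ i ∈ s, F i)) : ∃ i ∈ s, IsLarge lt j (F i) := by
  induction s, hs using Set.Finite.induction_on with
  | empty =>
    obtain ⟨x, hx⟩ := h.of_le (Nat.zero_le j)
    simp at hx
  | @insert a s _ _ ih =>
    rw [Set.biUnion_insert] at h
    rcases IsLarge.union j _ _ h with h | h
    · exact ⟨a, Set.mem_insert _ _, h⟩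
    · obtain ⟨i, hi, hl⟩ := ih h
      exact ⟨i, Set.mem_insert_of_mem _ hi, hl⟩

theorem HasPieces.image {ltV : V → V → Prop} {φ : V → W} {P : Set V → Prop} {Q : Set W → Prop}
    {X : Set V} {n : ℕ} (hφ : ∀ a ∈ X, ∀ b ∈ X, ltV a b → lt (φ a) (φ b))
    (hPQ : ∀ A ⊆ X, P A → Q (φ '' A)) (h : HasPieces ltV P n X) :
    HasPieces lt Q n (φ '' X) := by
  induction n generalizing X with
  | zero => trivial
  | succ n ih =>
    obtain ⟨A, B, hA, hB, hAB, hPA, hn⟩ := h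
    refine ⟨φ '' A, φ '' B, Set.image_mono hA, Set.image_mono hB, ?_, hPQ A hA hPA,
      ih (fun a ha b hb => hφ a (hB ha) b (hB hb)) (fun C hC => hPQ C (hC.trans hB)) hn⟩
    rintro _ ⟨a, ha, rfl⟩ _ ⟨b, hb, rfl⟩
    exact hφ a (hA ha) b (hB hb) (hAB a ha b hb)

theorem IsLarge.image {ltV : V → V → Prop} {φ : V → W} {X : Set V}
    (hφ : ∀ a ∈ X, ∀ b ∈ X, ltV a b → lt (φ a) (φ b)) (h : IsLarge ltV j X) :
    IsLarge lt j (φ '' X) := by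
  induction j generalizing X with
  | zero => exact Set.Nonempty.image φ h
  | succ j ih =>
    exact fun n => (h n).image hφ fun A hA hl =>
      ih (fun a ha b hb => hφ a (hA ha) b (hA hb)) hl

end Large

/-! ### Derivatives and well-foundedness -/

section WellOrder

variable {T : Type} [LinearOrder T]

/-- The least point of `D` at finite distance below `x` is in the derivative: a point finitely far
below it would also be finitely far below `x`. -/
theorem derivCofinite_of_wellFoundedLT [WellFoundedLT T] (D : Set T) :
    DerivCofinite (· < ·) D := by
  intro x hx
  have hne : {y | y ∈ D ∧ y ≤ x ∧ ¬ {z | z ∈ D ∧ y < z ∧ z < x}.Infinite}.Nonempty := by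
    refine ⟨x, hx, le_rfl, ?_⟩
    rw [Set.not_infinite]
    convert Set.finite_empty
    ext z
    simp only [Set.mem_ofPred_eq, Set.mem_empty_iff_false, iff_false]
    rintro ⟨-, h1, h2⟩
    exact lt_asymm h1 h2
  obtain ⟨y, ⟨hyD, hyx, hfin⟩, hmin⟩ := WellFounded.has_min (wellFounded_lt (α := T)) _ hne
  refine ⟨y, ⟨hyD, fun u hu huy => ?_⟩, not_lt.2 hyx, hfin⟩
  by_contra hinf
  refine hmin u ⟨hu, huy.le.trans hyx, ?_⟩ huy
  rw [Set.not_infinite] at hinf hfin ⊢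
  refine ((hinf.union hfin).union (Set.finite_singleton y)).subset ?_
  rintro z ⟨hz, h1, h2⟩
  rcases lt_trichotomy z y with h | h | h
  · exact Or.inl (Or.inl ⟨hz, h1, h⟩)
  · exact Or.inr h
  · exact Or.inl (Or.inr ⟨hz, h, h2⟩)

/-- Let `m` be the least derivative point finitely far below some point of `X`, say `x`. Every point
of `X` lies at or above such a derivative point, hence at or above `m`. So `X` has only finitely
many points up to `x`, and the least of these is the minimum. -/
theorem exists_min_of_derivCofinite {D : Set T} (hD : DerivCofinite (· < ·) D)
    (h : ∀ X ⊆ ordDeriv (· < ·) D, X.Nonempty → ∃ m ∈ X, ∀ x ∈ X, m ≤ x) :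
    ∀ X ⊆ D, X.Nonempty → ∃ m ∈ X, ∀ x ∈ X, m ≤ x := by
  intro X hX ⟨x₀, hx₀⟩
  let Y : Set T := {y | y ∈ ordDeriv (· < ·) D ∧
    ∃ x ∈ X, y ≤ x ∧ ¬ {z | z ∈ D ∧ y < z ∧ z < x}.Infinite}
  have hY : ∀ x ∈ X, ∃ y ∈ Y, y ≤ x ∧ ¬ {z | z ∈ D ∧ y < z ∧ z < x}.Infinite := by
    intro x hx
    obtain ⟨y, hy, h1, h2⟩ := hD x (hX hx)
    exact ⟨y, ⟨hy, x, hx, not_lt.1 h1, h2⟩, not_lt.1 h1, h2⟩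
  obtain ⟨y₀, hy₀, -⟩ := hY x₀ hx₀
  obtain ⟨m, ⟨-, x, hx, hmx, hfin⟩, hmin⟩ := h Y (fun y hy => hy.1) ⟨y₀, hy₀⟩
  have hF : (X ∩ Set.Iic x).Finite := by
    rw [Set.not_infinite] at hfin
    refine ((hfin.union (Set.finite_singleton m)).union (Set.finite_singleton x)).subset ?_
    rintro z ⟨hz, hzx⟩
    obtain ⟨y, hy, hyz, -⟩ := hY z hz
    rcases (hmin y hy).trans hyz |>.eq_or_lt with h | h
    · exact Or.inl (Or.inr h.symm)
    · rcases (show z ≤ x from hzx).eq_or_lt with h' | h'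
      · exact Or.inr h'
      · exact Or.inl (Or.inl ⟨hX hz, h, h'⟩)
  obtain ⟨u, hu, hu'⟩ := Set.exists_min_image _ id hF ⟨x, hx, le_rfl⟩
  refine ⟨u, hu.1, fun z hz => ?_⟩
  rcases le_total z x with h | h
  · exact hu' z ⟨hz, h⟩
  · exact (show u ≤ x from hu.2).trans h

theorem wellFoundedLT_of_derivCofinite (J : ℕ)
    (h : ∀ j < J, DerivCofinite (· < ·) (iterDeriv (· < ·) (Set.univ : Set T) j))
    (hJ : (iterDeriv (· < ·) (Set.univ : Set T) J).Subsingleton) : WellFoundedLT T := by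
  -- Minima are carried from level `J` down to level 0; `i` counts the levels already descended.
  have key : ∀ i ≤ J, ∀ X ⊆ iterDeriv (· < ·) (Set.univ : Set T) (J - i), X.Nonempty →
      ∃ m ∈ X, ∀ x ∈ X, m ≤ x := by
    intro i
    induction i with
    | zero =>
      rintro - X hX ⟨x, hx⟩
      exact ⟨x, hx, fun y hy => (hJ (hX hx) (hX hy)).le⟩
    | succ i ih =>
      intro hi
      refine exists_min_of_derivCofinite (h _ (by omega)) ?_
      have := ih (by omega)
      rwa [show J - i = J - (i + 1) + 1 by omega] at this
  refine ⟨WellFounded.wellFounded_iff_has_min.2 fun X hX => ?_⟩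
  obtain ⟨m, hm, hmin⟩ := key J le_rfl X (by simp [iterDeriv]) hX
  exact ⟨m, hm, fun x hx => not_lt.2 (hmin x hx)⟩

theorem isLarge_Ico [WellFoundedLT T] (D : Set T) (j : ℕ) :
    ∀ y ∈ iterDeriv (· < ·) D j, ∀ x, x ∈ iterDeriv (· < ·) D j → y < x →
      IsLarge (· < ·) j (Set.Ico y x) := by
  induction j with
  | zero => exact fun y _ x _ hyx => ⟨y, le_rfl, hyx⟩
  | succ j ih =>
    intro y hy x hx hyx n
    -- The inner induction moves `y` through points of level `j`, which need not be of level `j +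
    -- 1`. It only needs that infinitely many points of level `j` remain below `x`; passing to the
    -- next one, `z`, loses just `z`.
    have hinf := hx.2 y hy.1 hyx
    have hy' := hy.1
    clear hy hyx
    induction n generalizing y with
    | zero => trivial
    | succ n ihn =>
      obtain ⟨z, ⟨hz, hyz, hzx⟩, hmin⟩ :=
        WellFounded.has_min (wellFounded_lt (α := T)) _ hinf.nonempty
      refine ⟨Set.Ico y z, Set.Ico z x, Set.Ico_subset_Ico_right hzx.le,
        Set.Ico_subset_Ico_left hyz.le, fun a ha b hb => ha.2.trans_le hb.1,
        ih y hy' z hz hyz, ihn z (fun hfin => hinf ?_) hz⟩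
      refine (hfin.union (Set.finite_singleton z)).subset ?_
      rintro u ⟨hu, h1, h2⟩
      rcases lt_trichotomy u z with h | h | h
      · exact absurd h (hmin u ⟨hu, h1, h2⟩)
      · exact Or.inr h
      · exact Or.inl ⟨hu, h, h2⟩

end WellOrder

/-! ### Ordinals are determined by their tails -/

section Comparison

variable {A B : Type} [LinearOrder A] [LinearOrder B]

theorem bot_mem_iterDeriv {b : B} (hb : ∀ c, b ≤ c) (j : ℕ) :
    b ∈ iterDeriv (· < ·) (Set.univ : Set B) j := by
  induction j with
  | zero => trivial
  | succ j ih => exact ⟨ih, fun y _ hy => absurd hy (not_lt.2 (hb y))⟩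

/-- At the last level `j` of `B` with a point `c` at or above `f.top`, all of level `j + 1` lies
below `f.top` and hence comes from `A`. The tail of `A` is then the part of the tail of `B` below
`f.top`. This part is finite, since it lies between a derivative point and `c`, and it misses `c`,
so the two tails have different sizes. -/
theorem false_of_principalSeg [WellFoundedLT B] {J : ℕ}
    (hB : (iterDeriv (· < ·) (Set.univ : Set B) J).Subsingleton)
    (f : PrincipalSeg ((· < ·) : A → A → Prop) ((· < ·) : B → B → Prop))
    (hne : Nonempty B → Nonempty A)
    (he : ∀ j < J, (derivTail (· < ·) (iterDeriv (· < ·) (Set.univ : Set A) j)).encard =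
      (derivTail (· < ·) (iterDeriv (· < ·) (Set.univ : Set B) j)).encard) : False := by
  have hrange : ∀ c, c < f.top ↔ c ∈ Set.range f := fun c => (f.mem_range_iff_rel (b := c)).symm
  have hlt : ∀ a a', f a < f a' ↔ a < a' := fun a a' => f.map_rel_iff
  have hD : ∀ D : Set B, ∀ b ∈ D, ∀ a, b < f a → b ∈ Set.range f := fun D b _ a hb =>
    (hrange b).1 (hb.trans ((hrange _).2 ⟨a, rfl⟩))
  have hpre : ∀ j, f ⁻¹' iterDeriv (· < ·) (Set.univ : Set B) j =
      iterDeriv (· < ·) (Set.univ : Set A) j := fun j =>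
    preimage_iterDeriv f.injective hlt (hD _) j
  -- The only possible point of level `J` is the minimum of `B`, and that lies below `f.top` because
  -- `A` is nonempty.
  have hJ : ¬ ∃ c ∈ iterDeriv (· < ·) (Set.univ : Set B) J, f.top ≤ c := by
    rintro ⟨c, hc, htop⟩
    obtain ⟨a⟩ := hne ⟨c⟩
    obtain ⟨b, -, hb⟩ := WellFounded.has_min (wellFounded_lt (α := B)) Set.univ ⟨c, trivial⟩
    have hb' : ∀ c, b ≤ c := fun c => not_lt.1 (hb c trivial)
    have hcb := hB hc (bot_mem_iterDeriv hb' J)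
    have h1 : f a < f.top := (hrange _).2 ⟨a, rfl⟩
    exact absurd (hb' (f a)) (not_le.2 (h1.trans_le (htop.trans hcb.le)))
  obtain ⟨j, hj, ⟨c, hc, htop⟩, hnext⟩ : ∃ j < J,
      (∃ c ∈ iterDeriv (· < ·) (Set.univ : Set B) j, f.top ≤ c) ∧
      ¬ ∃ c ∈ iterDeriv (· < ·) (Set.univ : Set B) (j + 1), f.top ≤ c := by
    by_contra! hcon
    have : ∀ j ≤ J, ∃ c ∈ iterDeriv (· < ·) (Set.univ : Set B) j, f.top ≤ c := by
      intro j
      induction j with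
      | zero => exact fun _ => ⟨f.top, trivial, le_rfl⟩
      | succ j ih => exact fun hj => hcon j hj (ih (by omega))
    exact hJ (this J le_rfl)
  push Not at hnext
  obtain ⟨y, hy, hyc, hfin⟩ := derivCofinite_of_wellFoundedLT _ c hc
  have himage : f '' derivTail (· < ·) (iterDeriv (· < ·) (Set.univ : Set A) j) =
      derivTail (· < ·) (iterDeriv (· < ·) (Set.univ : Set B) j) ∩ Set.Iio f.top := by
    ext b
    constructor
    · rintro ⟨a, ⟨ha, ha'⟩, rfl⟩
      refine ⟨⟨by rwa [← hpre] at ha, fun z hz => ?_⟩, (hrange _).2 ⟨a, rfl⟩⟩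
      obtain ⟨z, rfl⟩ := (hrange z).1 (hnext z hz)
      refine (hlt _ _).2 (ha' z ?_)
      have : z ∈ f ⁻¹' iterDeriv (· < ·) (Set.univ : Set B) (j + 1) := hz
      rwa [hpre] at this
    · rintro ⟨⟨hb, hb'⟩, hbt⟩
      obtain ⟨a, rfl⟩ := (hrange b).1 hbt
      refine ⟨a, ⟨by rw [← hpre]; exact hb, fun z hz => (hlt _ _).1 (hb' _ ?_)⟩, rfl⟩
      have : z ∈ f ⁻¹' iterDeriv (· < ·) (Set.univ : Set B) (j + 1) := by rw [hpre]; exact hz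
      exact this
  have hfinite : (derivTail (· < ·) (iterDeriv (· < ·) (Set.univ : Set B) j) ∩
      Set.Iio f.top).Finite := by
    refine (Set.not_infinite.1 hfin).subset ?_
    rintro z ⟨⟨hz, hz'⟩, hzt⟩
    exact ⟨hz, hz' y hy, lt_of_lt_of_le hzt htop⟩
  have hss : derivTail (· < ·) (iterDeriv (· < ·) (Set.univ : Set B) j) ∩ Set.Iio f.top ⊂
      derivTail (· < ·) (iterDeriv (· < ·) (Set.univ : Set B) j) := by
    refine ⟨Set.inter_subset_left, fun h => ?_⟩
    have : c ∈ derivTail (· < ·) (iterDeriv (· < ·) (Set.univ : Set B) j) :=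
      ⟨hc, fun z hz => (hnext z hz).trans_le htop⟩
    exact absurd (h this).2 (not_lt.2 htop)
  have := hfinite.encard_lt_encard hss
  rw [← himage, f.injective.encard_image, he j hj] at this
  exact lt_irrefl _ this

/-- Of two well-orders one is an initial segment of the other, and a proper one is excluded.
Emptiness is compared separately because all tails of the one-point order are empty as well. -/
theorem nonempty_orderIso_iff [WellFoundedLT A] [WellFoundedLT B] {J : ℕ}
    (hA : (iterDeriv (· < ·) (Set.univ : Set A) J).Subsingleton)
    (hB : (iterDeriv (· < ·) (Set.univ : Set B) J).Subsingleton) :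
    Nonempty (A ≃o B) ↔ (Nonempty A ↔ Nonempty B) ∧
      ∀ j < J, (derivTail (· < ·) (iterDeriv (· < ·) (Set.univ : Set A) j)).encard =
        (derivTail (· < ·) (iterDeriv (· < ·) (Set.univ : Set B) j)).encard := by
  constructor
  · rintro ⟨f⟩
    refine ⟨f.toEquiv.nonempty_congr, fun j _ => ?_⟩
    have hD : ∀ D : Set B, D ⊆ Set.range f := fun D b _ => f.surjective b
    have hlt : ∀ a b, f a < f b ↔ a < b := fun a b => f.lt_iff_lt
    have := preimage_derivTail f.injective hlt (hD (iterDeriv (· < ·) Set.univ j))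
    rw [preimage_iterDeriv f.injective hlt (fun b _ _ _ => f.surjective b),
      Set.preimage_univ] at this
    rw [← this, Set.encard_preimage_of_injective_subset_range f.injective (hD _)]
  · rintro ⟨hne, he⟩
    rcases InitialSeg.total ((· < ·) : A → A → Prop) ((· < ·) : B → B → Prop) with f | f
    · rcases f.principalSumRelIso with g | g
      · exact (false_of_principalSeg hB g hne.2 he).elim
      · exact ⟨OrderIso.ofRelIsoLT g⟩
    · rcases f.principalSumRelIso with g | g
      · exact (false_of_principalSeg hA g hne.1 fun j hj => (he j hj).symm).elim
      · exact ⟨(OrderIso.ofRelIsoLT g).symm⟩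

end Comparison

/-! ### The rank bound for automatic ordinals -/

section Delhomme

/-- In a well-ordered set of words, the initial segments below the points have bounded rank: by
pigeonhole two of them would share the isomorphism type of a large piece. -/
theorem not_isLarge_initial {α : Type} {D : Set (List α)} {lt : List α → List α → Prop}
    {N₁ N₂ : ℕ} (hfin : ∀ t, (List.take t '' D).Finite)
    (hmin : ∀ X ⊆ D, X.Nonempty → ∃ m ∈ X, ∀ x ∈ X, ¬ lt x m) (hirr : ∀ x ∈ D, ¬ lt x x)
    (h₁ : HasIndex N₁ fun x : Fin 3 → List α => x 0 ∈ D ∧ lt (x 0) (x 1))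
    (h₂ : HasIndex N₂ fun x : Fin 3 → List α => lt (x 0) (x 1)) {x : List α} (hx : x ∈ D) :
    ¬ IsLarge lt (N₁ * N₂ + 1) {z | z ∈ D ∧ lt z x} := by
  intro hl
  have hpiece : ∀ j : Fin (N₁ * N₂ + 1), ∃ x u : List α, u.length = x.length ∧
      ¬ IsLarge lt (j + 2) {z | z ∈ D ∧ lt z x} ∧
      IsLarge lt (j + 1) {z | (z ∈ D ∧ lt z x) ∧ u <+: z} := by
    intro j
    -- `m` is the least point with an initial segment of size `ω ^ (j + 1)`. Finitely many prefixes
    -- of length at most that of `m` cover this segment, so by indivisibility one of them carries a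
    -- large part.
    obtain ⟨m, ⟨hmD, hm⟩, hmin'⟩ := hmin
      {x | x ∈ D ∧ IsLarge lt (j + 1) {z | z ∈ D ∧ lt z x}} (fun _ h => h.1)
      ⟨x, hx, hl.of_le (by omega)⟩
    have hcov : {z | z ∈ D ∧ lt z m} ⊆ ⋃ u ∈ List.take m.length '' D,
        {z | (z ∈ D ∧ lt z m) ∧ z.take m.length = u} := by
      intro z hz
      simp only [Set.mem_iUnion]
      exact ⟨_, ⟨z, hz.1, rfl⟩, hz, rfl⟩
    obtain ⟨u, ⟨w, hw, rfl⟩, hu⟩ := (hm.mono hcov).exists_of_biUnion (hfin _)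
    refine ⟨m, w.take m.length, ?_, ?_, hu.mono ?_⟩
    -- A prefix shorter than `m` is shared by one word only, whereas a large set has two distinct
    -- points.
    · by_contra hne
      obtain ⟨A, hA, hlA, b, hb, hAb⟩ := hu.exists_split
      obtain ⟨a, ha⟩ := hlA.of_le (Nat.zero_le _)
      have hs : ∀ z : List α, z.take m.length = w.take m.length → z = w.take m.length := by
        intro z hz
        have := congrArg List.length hz
        simp only [List.length_take] at this hne
        rwa [List.take_of_length_le (by omega)] at hz
      have := hAb a ha
      rw [hs a (hA ha).2, hs b hb.2] at this
      refine hirr _ ?_ this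
      rw [← hs b hb.2]
      exact hb.1.1
    -- Size `ω ^ (j + 2)` would put a point `b` below `m` whose initial segment already has size `ω
    -- ^ (j + 1)`.
    · intro hbig
      obtain ⟨A, hA, hlA, b, hb, hAb⟩ := hbig.exists_split
      exact hmin' b ⟨hb.1, hlA.mono fun a ha => ⟨(hA ha).1, hAb a ha⟩⟩ hb.2
    · rintro z ⟨hz, hzu⟩
      exact ⟨hz, hzu ▸ List.take_prefix _ _⟩
  choose X U hlen hsmall hlarge using hpiece
  obtain ⟨S₁, _, f₁, hc₁, hf₁⟩ := h₁
  obtain ⟨S₂, _, f₂, hc₂, hf₂⟩ := h₂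
  -- The first class determines which extensions of `U j` are in `D` and below `X j`, the second how
  -- they are ordered.
  let prof : Fin (N₁ * N₂ + 1) → S₁ × S₂ := fun j =>
    (f₁ (X j).length ![U j, X j, []], f₂ (X j).length ![U j, U j, []])
  obtain ⟨a, b, hab, e⟩ := Fintype.exists_ne_map_eq_of_card_lt prof (by
    rw [Fintype.card_prod, Fintype.card_fin]
    exact Nat.lt_succ_of_le (Nat.mul_le_mul hc₁ hc₂))
  wlog hlt : a < b generalizing a b
  · exact this b a hab.symm e.symm (lt_of_le_of_ne (not_lt.1 hlt) hab.symm)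
  obtain ⟨e₁, e₂⟩ := Prod.mk.inj e
  have ht : ∀ j, (U j).take (X j).length = U j := fun j => List.take_of_length_le (hlen j).le
  have k₁ : ∀ v, (U a ++ v ∈ D ∧ lt (U a ++ v) (X a)) ↔ (U b ++ v ∈ D ∧ lt (U b ++ v) (X b)) := by
    intro v
    have := hf₁ _ _ _ _ e₁ ![v, [], []]
    simpa [splice, hlen, ht] using this
  have k₂ : ∀ v w, lt (U a ++ v) (U a ++ w) ↔ lt (U b ++ v) (U b ++ w) := by
    intro v w
    have := hf₂ _ _ _ _ e₂ ![v, w, []]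
    simpa [splice, hlen, ht] using this
  -- Exchanging the prefix `U b` for `U a` moves a set of size `ω ^ (b + 1)` below `X a`, and `b + 1
  -- ≥ a + 2`.
  refine hsmall a (((hlarge b).of_le (i := a + 2) (by omega)).image (lt := lt)
    (φ := fun z => U a ++ z.drop (U b).length) ?_ |>.mono ?_)
  · rintro _ ⟨-, v, rfl⟩ _ ⟨-, w, rfl⟩ h
    simpa using (k₂ v w).2 h
  · rintro _ ⟨_, ⟨hz, v, rfl⟩, rfl⟩
    simpa using (k₁ v).2 hz

end Delhomme

/-! ### Testing derivatives on words of bounded length -/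

section Bounded

/-- An index bound for the derivative of a set whose index is at most `n`. -/
def derivBound (n : ℕ) : ℕ := n * 2 ^ (n * (n * 2 ^ (n * (n * n))))

theorem le_derivBound (n : ℕ) : n ≤ derivBound n :=
  Nat.le_mul_of_pos_right _ (by positivity)

theorem cube_le_derivBound (n : ℕ) : n * (n * n) ≤ derivBound n := by
  unfold derivBound
  refine Nat.mul_le_mul_left _ (Nat.lt_two_pow_self.le.trans ?_)
  refine Nat.pow_le_pow_right two_pos (Nat.mul_le_mul_left _ ?_)
  exact Nat.le_mul_of_pos_right _ (by positivity)

variable {α : Type} {lt : List α → List α → Prop} {D : Set (List α)} {n N M : ℕ}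

theorem unbounded_iff_infinite (hfin : ∀ t, {w | w ∈ D ∧ w.length ≤ t}.Finite)
    (p : List α → Prop) (hp : ∀ w, p w → w ∈ D) :
    (∀ n, ∃ w : List α, n ≤ w.length ∧ p w) ↔ {w | p w}.Infinite := by
  constructor
  · intro H hf
    obtain ⟨B, hB⟩ := (hf.image List.length).bddAbove
    obtain ⟨w, hw, hpw⟩ := H (B + 1)
    have := hB ⟨w, hpw, rfl⟩
    omega
  · intro H n
    by_contra! hc
    refine H ((hfin n).subset fun w hw => ⟨hp w hw, ?_⟩)
    by_contra hlen
    exact hc w (by omega) hw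

/-- The index of `D` and of `lt` is at most `n`. -/
structure RegularOrder (n : ℕ) (lt : List α → List α → Prop) (D : Set (List α)) : Prop where
  mem : ∀ i, HasIndex n fun x : Fin 3 → List α => x i ∈ D
  lt : ∀ i j, HasIndex n fun x : Fin 3 → List α => lt (x i) (x j)
  finite : ∀ t, {w | w ∈ D ∧ w.length ≤ t}.Finite

namespace RegularOrder

theorem between (h : RegularOrder n lt D) :
    HasIndex (n * (n * n))
      fun x : Fin 3 → List α => x 2 ∈ D ∧ lt (x 1) (x 2) ∧ lt (x 2) (x 0) :=
  (h.mem 2).and ((h.lt 1 2).and (h.lt 2 0))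

theorem infinite_between (h : RegularOrder n lt D) :
    HasIndex (2 ^ (n * (n * n))) fun x : Fin 3 → List α =>
      {z | z ∈ D ∧ lt (x 1) z ∧ lt z (x 0)}.Infinite := by
  refine (h.between.exUnbounded 2).congr fun x => ?_
  simp only [Function.update_apply]
  simpa using unbounded_iff_infinite h.finite
    (fun z => z ∈ D ∧ lt (x 1) z ∧ lt z (x 0)) fun _ hz => hz.1

theorem infinite_between_iff (h : RegularOrder n lt D) (hN : n * (n * n) ≤ N) {L : ℕ}
    {x y : List α} (hx : x.length ≤ L) (hy : y.length ≤ L) :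
    {z | z ∈ D ∧ lt y z ∧ lt z x}.Infinite ↔
      ∃ z ∈ D, L + N < z.length ∧ z.length ≤ L + 2 * N ∧ lt y z ∧ lt z x := by
  have key := (h.between.mono hN).unbounded_iff (L := L) (x := ![x, y, []]) (i := 2) (by
    intro j; fin_cases j <;> simp [hx, hy])
  simp only [Function.update_apply] at key
  simp only [Fin.isValue, ↓reduceIte, Fin.reduceEq, Matrix.cons_val_one, Matrix.cons_val_zero]
    at key
  rw [unbounded_iff_infinite h.finite
    (fun z => z ∈ D ∧ lt y z ∧ lt z x) fun _ hz => hz.1] at key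
  rw [key]
  exact exists_congr fun z => by tauto

/-- `x 1` witnesses that `x 0` is not in the derivative. -/
theorem close_below (h : RegularOrder n lt D) :
    HasIndex (n * (n * 2 ^ (n * (n * n)))) fun x : Fin 3 → List α =>
      x 1 ∈ D ∧ lt (x 1) (x 0) ∧ ¬ {z | z ∈ D ∧ lt (x 1) z ∧ lt z (x 0)}.Infinite :=
  (h.mem 1).and ((h.lt 1 0).and h.infinite_between.not)

/-- The value of `derivBound` is read off from this definition: one exponential for "infinitely
many", one for the quantifier over `y`. -/
theorem mem_ordDeriv (h : RegularOrder n lt D) :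
    HasIndex (derivBound n) fun x : Fin 3 → List α => x 0 ∈ ordDeriv lt D := by
  refine ((h.mem 0).and (h.close_below.ex 1).not).congr fun x => ?_
  simp [ordDeriv]

theorem ordDeriv (h : RegularOrder n lt D) : RegularOrder (derivBound n) lt (ordDeriv lt D) where
  mem i := h.mem_ordDeriv.reindex fun _ => i
  lt i j := (h.lt i j).mono (le_derivBound n)
  finite t := (h.finite t).subset fun _ hw => ⟨hw.1.1, hw.2⟩

theorem iterDeriv (h : RegularOrder n lt D) (j : ℕ) :
    RegularOrder (derivBound^[j] n) lt (iterDeriv lt D j) := by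
  induction j with
  | zero => exact h
  | succ j ih =>
    rw [Function.iterate_succ_apply']
    exact ih.ordDeriv

end RegularOrder

/-- The list `V` consists of the words of `D` of length at most `M`. -/
def ListsUpTo (V : List (List α)) (D : Set (List α)) (M : ℕ) : Prop :=
  ∀ x, x ∈ V ↔ x ∈ D ∧ x.length ≤ M

/-- Some word in `V` of length more than `B` lies between `y` and `x`. -/
def LongBetween (lt : List α → List α → Prop) (V : List (List α)) (B : ℕ) (y x : List α) : Prop :=
  ∃ z ∈ V, B < z.length ∧ lt y z ∧ lt z x

open Classical in
-- Meant for a list `V` complete up to length `M + 3 * N`: for `x` up to length `M`, an excluding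
-- `y` is sought up to `M + N`, and infinity of the interval between them shows in lengths from `M +
-- 2 * N` to `M + 3 * N`.
noncomputable def derivList (lt : List α → List α → Prop) (N M : ℕ) (V : List (List α)) :
    List (List α) :=
  V.filter fun x => x.length ≤ M ∧
    ∀ y ∈ V, y.length ≤ M + N → lt y x → LongBetween lt V (M + 2 * N) y x

def CofiniteCheck (lt : List α → List α → Prop) (N M : ℕ) (V V' : List (List α)) : Prop :=
  ∀ x ∈ V, x.length ≤ N → ∃ y ∈ V', ¬ lt x y ∧ ¬ LongBetween lt V (M + 2 * N) y x

open Classical in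
noncomputable def tailList (lt : List α → List α → Prop) (N : ℕ) (V V' : List (List α)) :
    List (List α) :=
  V.filter fun x => x.length ≤ 2 * N ∧ ∀ y ∈ V', lt y x

open Classical in
/-- One more than the length of `E`, or `0` if `E` has a word of length more than `N`. -/
noncomputable def sizeCode (N : ℕ) (E : List (List α)) : ℕ :=
  if ∃ x ∈ E, N < x.length then 0 else E.length + 1

variable {V V' : List (List α)}

theorem ListsUpTo.longBetween_iff (hV : ListsUpTo V D (M + 3 * N)) (h : RegularOrder n lt D)
    (hN : n * (n * n) ≤ N) {x y : List α} (hx : x.length ≤ M + N) (hy : y.length ≤ M + N) :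
    LongBetween lt V (M + 2 * N) y x ↔ {z | z ∈ D ∧ lt y z ∧ lt z x}.Infinite := by
  rw [h.infinite_between_iff hN hx hy]
  constructor
  · rintro ⟨z, hz, h1, h2⟩
    exact ⟨z, ((hV z).1 hz).1, by omega, by have := ((hV z).1 hz).2; omega, h2⟩
  · rintro ⟨z, hz, h1, h2, h3⟩
    exact ⟨z, (hV z).2 ⟨hz, by omega⟩, by omega, h3⟩

theorem ListsUpTo.derivList (hV : ListsUpTo V D (M + 3 * N)) (h : RegularOrder n lt D)
    (hN : derivBound (derivBound n) ≤ N) : ListsUpTo (derivList lt N M V) (ordDeriv lt D) M := by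
  have hn1 := cube_le_derivBound n
  have hn2 := le_derivBound (derivBound n)
  have hcl : n * (n * 2 ^ (n * (n * n))) ≤ N := by
    refine le_trans ?_ ((hn2.trans hN))
    rcases n.eq_zero_or_pos with rfl | hpos
    · simp
    · exact Nat.lt_two_pow_self.le.trans (Nat.le_mul_of_pos_left _ hpos)
  intro x
  simp only [_root_.derivList, List.mem_filter, decide_eq_true_eq, hV x]
  constructor
  · rintro ⟨⟨hxD, -⟩, hxM, H⟩
    refine ⟨⟨hxD, ?_⟩, hxM⟩
    by_contra! hc
    obtain ⟨y, hy, hyx, hf⟩ := hc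
    obtain ⟨y', hl, hy', hyx', hf'⟩ := (h.close_below.mono hcl).exists_short_update (L := M)
      (x := ![x, [], []]) (i := 1) (w := y) (by intro j; fin_cases j <;> simp [hxM])
      ⟨hy, hyx, Set.not_infinite.2 hf⟩
    have := H y' ((hV y').2 ⟨hy', by omega⟩) hl hyx'
    rw [hV.longBetween_iff h (by omega) (by omega) hl] at this
    exact hf' this
  · rintro ⟨⟨hxD, H⟩, hxM⟩
    refine ⟨⟨hxD, by omega⟩, hxM, fun y hy hyl hyx => ?_⟩
    rw [hV.longBetween_iff h (by omega) (by omega) hyl]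
    exact H y ((hV y).1 hy).1 hyx

/-- A failure of cofiniteness has an `x` of length at most `N`, and a suitable `y` for such an `x`
can be taken of length at most `2 * N ≤ M`. The condition quantifies over the derivative, whose
index is already `derivBound n`; hence the second `derivBound`. -/
theorem derivCofinite_iff (hV : ListsUpTo V D (M + 3 * N)) (hV' : ListsUpTo V' (ordDeriv lt D) M)
    (h : RegularOrder n lt D) (hN : derivBound (derivBound n) ≤ N) (hM : 2 * N ≤ M) :
    DerivCofinite lt D ↔ CofiniteCheck lt N M V V' := by
  have hn1 := cube_le_derivBound n
  have hn2 := le_derivBound (derivBound n)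
  have hin : HasIndex (derivBound n * (n * 2 ^ (n * (n * n)))) fun x : Fin 3 → List α =>
      x 1 ∈ ordDeriv lt D ∧ ¬ lt (x 0) (x 1) ∧
        ¬ {z | z ∈ D ∧ lt (x 1) z ∧ lt z (x 0)}.Infinite :=
    (h.ordDeriv.mem 1).and ((h.lt 0 1).not.and h.infinite_between.not)
  have hout : HasIndex (n * 2 ^ (derivBound n * (n * 2 ^ (n * (n * n))))) fun x : Fin 3 → List α =>
      x 0 ∈ D ∧ ¬ ∃ y ∈ ordDeriv lt D, ¬ lt (x 0) y ∧
        ¬ {z | z ∈ D ∧ lt y z ∧ lt z (x 0)}.Infinite := by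
    refine ((h.mem 0).and (hin.ex 1).not).congr fun x => ?_
    simp
  have hn0 := le_derivBound n
  have hnI : n * 2 ^ (n * (n * n)) ≤
      derivBound n * 2 ^ (derivBound n * (derivBound n * derivBound n)) :=
    Nat.mul_le_mul hn0 (Nat.pow_le_pow_right two_pos
      (Nat.mul_le_mul hn0 (Nat.mul_le_mul hn0 hn0)))
  have hout' : n * 2 ^ (derivBound n * (n * 2 ^ (n * (n * n)))) ≤ N := by
    refine le_trans ?_ hN
    conv_rhs => unfold derivBound
    exact Nat.mul_le_mul hn0 (Nat.pow_le_pow_right two_pos (Nat.mul_le_mul_left _ hnI))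
  have hin' : derivBound n * (n * 2 ^ (n * (n * n))) ≤ N := by
    refine le_trans (Nat.mul_le_mul_left _ ?_) hN
    refine le_trans ?_ Nat.lt_two_pow_self.le
    refine hnI.trans ?_
    rcases (derivBound n).eq_zero_or_pos with h0 | hpos
    · simp [h0]
    · exact Nat.le_mul_of_pos_left _ hpos
  constructor
  · intro H x hx hxN
    obtain ⟨hxD, -⟩ := (hV x).1 hx
    obtain ⟨y, hy, hxy, hf⟩ := H x hxD
    obtain ⟨y', hl, hy', hyx', hf'⟩ := (hin.mono hin').exists_short_update (L := N)
      (x := ![x, [], []]) (i := 1) (w := y) (by intro j; fin_cases j <;> simp [hxN])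
      ⟨hy, hxy, hf⟩
    refine ⟨y', (hV' y').2 ⟨hy', by omega⟩, hyx', ?_⟩
    rw [hV.longBetween_iff h (by omega) (by omega) (by omega)]
    exact hf'
  · intro H
    unfold DerivCofinite
    by_contra! hc
    obtain ⟨x, hx, hc⟩ := hc
    obtain ⟨x', ⟨hx'D, hx'⟩, -, hl⟩ := (hout.mono hout').exists_short 0 ![x, [], []]
      ⟨hx, by simpa using hc⟩
    have hl0 := hl 0
    obtain ⟨y, hy, hxy, hb⟩ := H (x' 0) ((hV _).2 ⟨hx'D, by omega⟩) (by omega)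
    obtain ⟨hyD, hyM⟩ := (hV' y).1 hy
    rw [hV.longBetween_iff h (by omega) (by omega) (by omega)] at hb
    exact hx' ⟨y, hyD, hxy, hb⟩

/-- The tail is infinite exactly when it has a word of length in `(N, 2 * N]`; otherwise all its
words have length at most `N` and the list is complete. Testing a word of length at most `2 * N`
needs derivative points up to `3 * N ≤ M`. -/
theorem encard_derivTail (hV : ListsUpTo V D (M + 3 * N)) (hV' : ListsUpTo V' (ordDeriv lt D) M)
    (hnd : V.Nodup) (h : RegularOrder n lt D) (hN : derivBound (derivBound n) ≤ N)
    (hM : 3 * N ≤ M) :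
    (derivTail lt D).encard =
      if sizeCode N (tailList lt N V V') = 0 then ⊤
      else ((sizeCode N (tailList lt N V V') - 1 : ℕ) : ℕ∞) := by
  classical
  have hn1 := cube_le_derivBound n
  have hn2 := le_derivBound (derivBound n)
  have hin : HasIndex (derivBound n * n) fun x : Fin 3 → List α =>
      x 1 ∈ ordDeriv lt D ∧ ¬ lt (x 1) (x 0) :=
    (h.ordDeriv.mem 1).and (h.lt 1 0).not
  have hout : HasIndex (n * 2 ^ (derivBound n * n)) fun x : Fin 3 → List α =>
      x 0 ∈ derivTail lt D := by
    refine ((h.mem 0).and (hin.ex 1).not).congr fun x => ?_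
    simp [derivTail]
  have hn0 := le_derivBound n
  have hout' : n * 2 ^ (derivBound n * n) ≤ N := by
    refine le_trans ?_ hN
    conv_rhs => unfold derivBound
    refine Nat.mul_le_mul hn0 (Nat.pow_le_pow_right two_pos (Nat.mul_le_mul_left _ ?_))
    exact hn0.trans (Nat.le_mul_of_pos_right _ (by positivity))
  have hin' : derivBound n * n ≤ N := by
    refine le_trans (Nat.mul_le_mul_left _ ?_) ((cube_le_derivBound _).trans hN)
    exact hn0.trans (Nat.le_mul_self _)
  have hmem : ∀ x, x ∈ tailList lt N V V' ↔ x ∈ derivTail lt D ∧ x.length ≤ 2 * N := by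
    intro x
    simp only [tailList, List.mem_filter, decide_eq_true_eq, hV x]
    constructor
    · rintro ⟨⟨hxD, -⟩, hxN, H⟩
      refine ⟨⟨hxD, ?_⟩, hxN⟩
      by_contra! hc
      obtain ⟨y, hy, hyx⟩ := hc
      obtain ⟨y', hl, hy', hyx'⟩ := (hin.mono hin').exists_short_update (L := 2 * N)
        (x := ![x, [], []]) (i := 1) (w := y) (by intro j; fin_cases j <;> simp [hxN])
        ⟨hy, hyx⟩
      exact hyx' (H y' ((hV' y').2 ⟨hy', by omega⟩))
    · rintro ⟨⟨hxD, H⟩, hxN⟩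
      exact ⟨⟨hxD, by omega⟩, hxN, fun y hy => H y ((hV' y).1 hy).1⟩
  have hupd : ∀ w, Function.update (![[], [], []] : Fin 3 → List α) 0 w 0 = w := by simp
  have hshort : ∀ j : Fin 3, j ≠ 0 → ((![[], [], []] : Fin 3 → List α) j).length ≤ 0 := by
    intro j; fin_cases j <;> simp
  unfold sizeCode
  by_cases hlong : ∃ x ∈ tailList lt N V V', N < x.length
  · rw [if_pos hlong, if_pos rfl, Set.encard_eq_top_iff]
    obtain ⟨x, hx, hxN⟩ := hlong
    have := ((hout.mono hout').unbounded_iff (L := 0) (i := 0) hshort).2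
      ⟨x, by omega, by have := ((hmem x).1 hx).2; omega, by rw [hupd]; exact ((hmem x).1 hx).1⟩
    simp only [hupd] at this
    exact (unbounded_iff_infinite h.finite (· ∈ derivTail lt D) fun _ hw => hw.1).1 this
  · rw [if_neg hlong, if_neg (by omega), Nat.add_sub_cancel]
    have heq : derivTail lt D = ↑(tailList lt N V V').toFinset := by
      ext x
      simp only [List.coe_toFinset, Set.mem_ofPred_eq, hmem]
      refine ⟨fun hx => ⟨hx, ?_⟩, fun hx => hx.1⟩
      by_contra hxl
      obtain ⟨x', h1, h2, h3⟩ := (hout.mono hout').exists_long_short (L := 0) (i := 0) hshort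
        (w := x) (by omega) (by rw [hupd]; exact hx)
      rw [hupd] at h3
      exact hlong ⟨x', (hmem _).2 ⟨h3, by omega⟩, by omega⟩
    rw [heq, Set.encard_coe_eq_coe_finsetCard, List.toFinset_card_of_nodup]
    exact hnd.filter _

end Bounded

/-! ### Automata define relations of finite index -/

section BaseIndex

variable {ι α : Type}

theorem splice_eq_take_append (t : ℕ) (x y : ι → List α) (i : ι) :
    splice t x y i = (x i).take t ++ if t ≤ (x i).length then y i else [] := by
  by_cases h : t ≤ (x i).length
  · simp [splice, h]
  · simp [splice, h, List.take_of_length_le (not_le.1 h).le]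

/-- Besides the set of reachable states, the class records whether the word reaches position `t`,
because `splice` ignores the continuation of a word that has already ended. -/
theorem hasIndex_accepts {σ : Type} [Fintype σ] (M : NFA α σ) (i : ι) :
    HasIndex (2 * 2 ^ Fintype.card σ) fun x : ι → List α => x i ∈ M.accepts := by
  classical
  refine ⟨Bool × Set σ, inferInstance,
    fun t x => (decide (t ≤ (x i).length), M.evalFrom M.start ((x i).take t)), ?_, ?_⟩
  · simp
  · intro t x t' x' e y
    obtain ⟨e₁, e₂⟩ := Prod.mk.inj e
    rw [decide_eq_decide] at e₁
    simp only [NFA.mem_accepts, splice_eq_take_append, NFA.evalFrom_append, e₁, e₂]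

theorem hasIndex_forall_mem (p : α → Prop) (i : ι) :
    HasIndex 4 fun x : ι → List α => ∀ a ∈ x i, p a := by
  classical
  refine ⟨Bool × Bool, inferInstance,
    fun t x => (decide (t ≤ (x i).length), decide (∀ a ∈ (x i).take t, p a)), by simp, ?_⟩
  intro t x t' x' e y
  obtain ⟨e₁, e₂⟩ := Prod.mk.inj e
  rw [decide_eq_decide] at e₁ e₂
  simp only [splice_eq_take_append, List.forall_mem_append, e₁, e₂]

theorem hasIndex_eq (i j : ι) : HasIndex 8 fun x : ι → List α => x i = x j := by
  classical
  refine ⟨Bool × Bool × Bool, inferInstance,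
    fun t x => (decide (t ≤ (x i).length), decide (t ≤ (x j).length),
      decide ((x i).take t = (x j).take t)), by simp, ?_⟩
  have key : ∀ t (x y : ι → List α), splice t x y i = splice t x y j ↔
      (x i).take t = (x j).take t ∧ ((t ≤ (x i).length ↔ t ≤ (x j).length) ∧
        (t ≤ (x i).length → y i = y j)) := by
    intro t x y
    by_cases hi : t ≤ (x i).length <;> by_cases hj : t ≤ (x j).length
    · rw [splice_eq_take_append, splice_eq_take_append, if_pos hi, if_pos hj,
        List.append_eq_append_iff_of_size_eq_left (by simp [hi, hj])]
      simp [hi, hj]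
    · simp only [hi, hj, splice, if_true, if_false]
      refine ⟨fun h => ?_, fun h => by simp at h⟩
      have := congrArg List.length h
      simp at this
      omega
    · simp only [hi, hj, splice, if_true, if_false]
      refine ⟨fun h => ?_, fun h => by simp at h⟩
      have := congrArg List.length h
      simp at this
      omega
    · simp [hi, hj, splice, List.take_of_length_le (not_le.1 hi).le,
        List.take_of_length_le (not_le.1 hj).le]
  intro t x t' x' e y
  obtain ⟨e₁, e₂⟩ := Prod.mk.inj e
  obtain ⟨e₂, e₃⟩ := Prod.mk.inj e₂
  rw [decide_eq_decide] at e₁ e₂ e₃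
  simp only [key, e₁, e₂, e₃]

theorem wordConvolution_append {u v : List α} (h : u.length = v.length) (y z : List α) :
    wordConvolution (u ++ y) (v ++ z) = wordConvolution u v ++ wordConvolution y z := by
  induction u generalizing v with
  | nil =>
    obtain rfl : v = [] := List.length_eq_zero_iff.1 h.symm
    simp [wordConvolution]
  | cons a u ih =>
    cases v with
    | nil => simp at h
    | cons b v =>
      have := ih (by simpa using h)
      simp_all [wordConvolution]

theorem wordConvolution_append_left {u v : List α} (h : v.length ≤ u.length) (y : List α) :
    wordConvolution (u ++ y) v = wordConvolution u v ++ wordConvolution y [] := by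
  induction u generalizing v with
  | nil =>
    obtain rfl : v = [] := List.length_eq_zero_iff.1 (by simpa using h)
    simp [wordConvolution]
  | cons a u ih =>
    cases v with
    | nil => simp [wordConvolution]
    | cons b v =>
      have := ih (by simpa using h)
      simp_all [wordConvolution]

theorem wordConvolution_append_right {u v : List α} (h : u.length ≤ v.length) (y : List α) :
    wordConvolution u (v ++ y) = wordConvolution u v ++ wordConvolution [] y := by
  induction v generalizing u with
  | nil =>
    obtain rfl : u = [] := List.length_eq_zero_iff.1 (by simpa using h)
    simp [wordConvolution]
  | cons a v ih =>
    cases u with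
    | nil => simp [wordConvolution]
    | cons b u =>
      have := ih (by simpa using h)
      simp_all [wordConvolution]

theorem wordConvolution_map {β : Type} (f : α → β) (u v : List α) :
    wordConvolution (u.map f) (v.map f) =
      (wordConvolution u v).map fun a => (a.1.map f, a.2.map f) := by
  induction u generalizing v with
  | nil => simp [wordConvolution]
  | cons a u ih =>
    cases v with
    | nil => simp [wordConvolution]
    | cons b v =>
      have := ih v
      simp_all [wordConvolution]

theorem wordConvolution_splice (t : ℕ) (x y : ι → List α) (i j : ι) :
    wordConvolution (splice t x y i) (splice t x y j) =
      wordConvolution ((x i).take t) ((x j).take t) ++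
        wordConvolution (if t ≤ (x i).length then y i else [])
          (if t ≤ (x j).length then y j else []) := by
  rw [splice_eq_take_append, splice_eq_take_append]
  split_ifs with hi hj hj
  · exact wordConvolution_append (by simp [hi, hj]) _ _
  · rw [List.append_nil]
    exact wordConvolution_append_left (by simp; omega) _
  · rw [List.append_nil]
    exact wordConvolution_append_right (by simp; omega) _
  · simp [wordConvolution]

theorem hasIndex_convolution_accepts {σ : Type} [Fintype σ] (M : NFA (Option α × Option α) σ)
    (i j : ι) : HasIndex (4 * 2 ^ Fintype.card σ)
      fun x : ι → List α => wordConvolution (x i) (x j) ∈ M.accepts := by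
  classical
  refine ⟨(Bool × Bool) × Set σ, inferInstance,
    fun t x => ((decide (t ≤ (x i).length), decide (t ≤ (x j).length)),
      M.evalFrom M.start (wordConvolution ((x i).take t) ((x j).take t))), ?_, ?_⟩
  · simp
  · intro t x t' x' e y
    obtain ⟨e₁, e₂⟩ := Prod.mk.inj e
    obtain ⟨e₁, e₃⟩ := Prod.mk.inj e₁
    rw [decide_eq_decide] at e₁ e₃
    simp only [NFA.mem_accepts, wordConvolution_splice, NFA.evalFrom_append, e₁, e₂, e₃]

end BaseIndex

/-! ### Presentations as orders on words of numbers -/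

theorem WordAutomaton.mem_accepts_map {α β : Type} (A : WordAutomaton β) (code : α → β)
    (w : List α) : w ∈ (A.toNFA code).accepts ↔ w.map code ∈ (A.toNFA id).accepts := by
  have : ∀ S, (A.toNFA code).evalFrom S w = (A.toNFA id).evalFrom S (w.map code) := by
    induction w with
    | nil => exact fun S => rfl
    | cons a w ih => exact fun S => ih _
  simp only [NFA.mem_accepts, this]
  rfl

namespace AutomaticPresentation

variable (P : AutomaticPresentation)

/-- The domain, as a set of words of numbers. -/
def domainSet : Set (List ℕ) :=
  {w | (∀ a ∈ w, a < P.alphabetSize) ∧ w ∈ (P.domain.toNFA id).accepts}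

def wordLe (x y : List ℕ) : Prop := wordConvolution x y ∈ (P.relation.toNFA id).accepts

def wordLt (x y : List ℕ) : Prop := P.wordLe x y ∧ x ≠ y

/-- Transfers the structure to `List ℕ`, a type independent of the alphabet, on which one algorithm
serves all presentations. -/
def toWord (x : P.Carrier) : List ℕ := x.1.map Fin.val

theorem toWord_injective : Function.Injective P.toWord := fun _ _ h =>
  Subtype.ext (List.map_injective_iff.2 Fin.val_injective h)

theorem range_toWord : Set.range P.toWord = P.domainSet := by
  ext w
  constructor
  · rintro ⟨x, rfl⟩
    refine ⟨?_, (P.domain.mem_accepts_map _ _).1 x.2⟩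
    intro a ha
    obtain ⟨b, -, rfl⟩ := List.mem_map.1 ha
    exact b.2
  · rintro ⟨hw, hacc⟩
    obtain ⟨v, rfl⟩ : ∃ v : List (Fin P.alphabetSize), v.map Fin.val = w :=
      ⟨w.pmap (fun a h => ⟨a, h⟩) hw, by simp [List.map_pmap]⟩
    exact ⟨⟨v, (P.domain.mem_accepts_map _ _).2 hacc⟩, rfl⟩

theorem toWord_mem (x : P.Carrier) : P.toWord x ∈ P.domainSet := by
  rw [← P.range_toWord]; exact Set.mem_range_self x

theorem wordLe_toWord (x y : P.Carrier) : P.wordLe (P.toWord x) (P.toWord y) ↔ P.Le x y := by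
  unfold wordLe Le relationLanguage toWord
  rw [wordConvolution_map]
  exact (P.relation.mem_accepts_map _ _).symm

theorem wordLt_toWord (x y : P.Carrier) :
    P.wordLt (P.toWord x) (P.toWord y) ↔ P.Le x y ∧ x ≠ y := by
  rw [wordLt, wordLe_toWord, P.toWord_injective.ne_iff]

/-- An index bound for the domain, the relation, and equality. -/
def baseIndex : ℕ := 8 * 2 ^ (P.domain.numStates + P.relation.numStates)

/-- Six factors are needed for a failure of transitivity: three memberships and three comparisons.
The rank bound needs five. -/
def orderIndex : ℕ := P.baseIndex ^ 6

theorem hasIndex_domain {ι : Type} (i : ι) :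
    HasIndex P.baseIndex fun x : ι → List ℕ => x i ∈ P.domainSet := by
  refine ((hasIndex_forall_mem (· < P.alphabetSize) i).and
    (hasIndex_accepts (P.domain.toNFA id) i)).mono ?_
  rw [Fintype.card_fin, baseIndex, pow_add]
  have : 0 < 2 ^ P.relation.numStates := by positivity
  nlinarith [Nat.zero_le (2 ^ P.domain.numStates), Nat.le_mul_of_pos_right (2 ^ P.domain.numStates) this]

theorem hasIndex_wordLe {ι : Type} (i j : ι) :
    HasIndex P.baseIndex fun x : ι → List ℕ => P.wordLe (x i) (x j) := by
  refine (hasIndex_convolution_accepts (P.relation.toNFA id) i j).mono ?_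
  rw [Fintype.card_fin, baseIndex, pow_add]
  have : 0 < 2 ^ P.domain.numStates := by positivity
  nlinarith [Nat.zero_le (2 ^ P.relation.numStates), Nat.le_mul_of_pos_left (2 ^ P.relation.numStates) this]

theorem hasIndex_word_eq {ι : Type} (i j : ι) :
    HasIndex P.baseIndex fun x : ι → List ℕ => x i = x j :=
  (hasIndex_eq i j).mono (Nat.le_mul_of_pos_right _ (by positivity))

theorem hasIndex_wordLt {ι : Type} (i j : ι) :
    HasIndex (P.baseIndex * P.baseIndex) fun x : ι → List ℕ => P.wordLt (x i) (x j) :=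
  (P.hasIndex_wordLe i j).and (P.hasIndex_word_eq i j).not

theorem baseIndex_pos : 0 < P.baseIndex := by unfold baseIndex; positivity

theorem finite_take_domainSet (t : ℕ) : (List.take t '' P.domainSet).Finite := by
  refine ((List.finite_length_le (Fin P.alphabetSize) t).image (List.map Fin.val)).subset ?_
  rintro _ ⟨w, hw, rfl⟩
  rw [← P.range_toWord] at hw
  obtain ⟨x, rfl⟩ := hw
  exact ⟨x.1.take t, by simp, by simp [toWord, List.map_take]⟩

theorem regularOrder {n : ℕ} (hn : P.orderIndex ≤ n) :
    RegularOrder n P.wordLt P.domainSet where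
  mem i := (P.hasIndex_domain i).mono ((Nat.le_self_pow (by norm_num) _).trans hn)
  lt i j := (P.hasIndex_wordLt i j).mono (by
    refine le_trans ?_ hn
    rw [← sq]
    exact Nat.pow_le_pow_right P.baseIndex_pos (by norm_num))
  finite t := (P.finite_take_domainSet t).subset fun w hw => ⟨w, hw.1, List.take_of_length_le hw.2⟩

/-- The relation is a linear order on the words of `D`. -/
def LinearOn (le : List ℕ → List ℕ → Prop) (D : List ℕ → Prop) : Prop :=
  (∀ x, D x → ∀ y, D y → le x y ∨ le y x) ∧
  (∀ x, D x → ∀ y, D y → le x y → le y x → x = y) ∧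
  ∀ x, D x → ∀ y, D y → ∀ z, D z → le x y → le y z → le x z

theorem isLinearOrder_iff :
    IsLinearOrder P.Carrier P.Le ↔ LinearOn P.wordLe (· ∈ P.domainSet) := by
  simp only [LinearOn, ← P.range_toWord, Set.forall_mem_range, wordLe_toWord,
    P.toWord_injective.eq_iff]
  constructor
  · intro h
    exact ⟨fun x y => h.total x y, fun x y => h.antisymm x y, fun x y z => h.trans x y z⟩
  · rintro ⟨h1, h2, h3⟩
    exact { refl := fun x => (h1 x x).elim id id, trans := h3, antisymm := h2, total := h1 }

/-- Failure of an axiom of linear orders is a relation of index at most `n`, so it has a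
counterexample with words of length at most `n`. -/
theorem linearOn_iff {n M : ℕ} {V : List (List ℕ)} (hV : ListsUpTo V P.domainSet M)
    (hn : P.orderIndex ≤ n) (hM : n ≤ M) :
    LinearOn P.wordLe (· ∈ P.domainSet) ↔ LinearOn P.wordLe (· ∈ V) := by
  have hsub : ∀ x, x ∈ V → x ∈ P.domainSet := fun x hx => ((hV x).1 hx).1
  constructor
  · rintro ⟨h1, h2, h3⟩
    exact ⟨fun x hx y hy => h1 x (hsub x hx) y (hsub y hy),
      fun x hx y hy => h2 x (hsub x hx) y (hsub y hy),
      fun x hx y hy z hz => h3 x (hsub x hx) y (hsub y hy) z (hsub z hz)⟩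
  · rintro ⟨h1, h2, h3⟩
    have hpow : ∀ k, k ≤ 6 → P.baseIndex ^ k ≤ n := fun k hk =>
      (Nat.pow_le_pow_right P.baseIndex_pos hk).trans hn
    have hmem : ∀ x, x ∈ P.domainSet → x.length ≤ 0 + n → x ∈ V := fun x hx hl =>
      (hV x).2 ⟨hx, by omega⟩
    refine ⟨?_, ?_, ?_⟩
    · by_contra! hc
      obtain ⟨x, hx, y, hy, hxy⟩ := hc
      have hi : HasIndex n fun x : Fin 2 → List ℕ => x 0 ∈ P.domainSet ∧ x 1 ∈ P.domainSet ∧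
          ¬ P.wordLe (x 0) (x 1) ∧ ¬ P.wordLe (x 1) (x 0) :=
        ((P.hasIndex_domain 0).and ((P.hasIndex_domain 1).and
          ((P.hasIndex_wordLe 0 1).not.and (P.hasIndex_wordLe 1 0).not))).mono
          (le_trans (by ring_nf; rfl) (hpow 4 (by norm_num)))
      obtain ⟨w, ⟨a, b, c, d⟩, -, hl⟩ := hi.exists_short 0 ![x, y] ⟨hx, hy, hxy⟩
      exact (h1 _ (hmem _ a (hl 0)) _ (hmem _ b (hl 1))).elim c d
    · by_contra! hc
      obtain ⟨x, hx, y, hy, hxy, hyx, hne⟩ := hc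
      have hi : HasIndex n fun x : Fin 2 → List ℕ => x 0 ∈ P.domainSet ∧ x 1 ∈ P.domainSet ∧
          P.wordLe (x 0) (x 1) ∧ P.wordLe (x 1) (x 0) ∧ ¬ x 0 = x 1 :=
        ((P.hasIndex_domain 0).and ((P.hasIndex_domain 1).and
          ((P.hasIndex_wordLe 0 1).and ((P.hasIndex_wordLe 1 0).and
            (P.hasIndex_word_eq 0 1).not)))).mono
          (le_trans (by ring_nf; rfl) (hpow 5 (by norm_num)))
      obtain ⟨w, ⟨a, b, c, d, e⟩, -, hl⟩ := hi.exists_short 0 ![x, y] ⟨hx, hy, hxy, hyx, hne⟩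
      exact e (h2 _ (hmem _ a (hl 0)) _ (hmem _ b (hl 1)) c d)
    · by_contra! hc
      obtain ⟨x, hx, y, hy, z, hz, hxy, hyz, hxz⟩ := hc
      have hi : HasIndex n fun x : Fin 3 → List ℕ => x 0 ∈ P.domainSet ∧ x 1 ∈ P.domainSet ∧
          x 2 ∈ P.domainSet ∧
          P.wordLe (x 0) (x 1) ∧ P.wordLe (x 1) (x 2) ∧ ¬ P.wordLe (x 0) (x 2) :=
        ((P.hasIndex_domain 0).and ((P.hasIndex_domain 1).and ((P.hasIndex_domain 2).and
          ((P.hasIndex_wordLe 0 1).and ((P.hasIndex_wordLe 1 2).and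
            (P.hasIndex_wordLe 0 2).not))))).mono
          (le_trans (by ring_nf; rfl) (hpow 6 le_rfl))
      obtain ⟨w, ⟨a, b, c, d, e, f⟩, -, hl⟩ :=
        hi.exists_short 0 ![x, y, z] ⟨hx, hy, hz, hxy, hyz, hxz⟩
      exact f (h3 _ (hmem _ a (hl 0)) _ (hmem _ b (hl 1)) _ (hmem _ c (hl 2)) d e)

/-- The linear order on the carrier. -/
noncomputable abbrev linearOrder (h : IsLinearOrder P.Carrier P.Le) : LinearOrder P.Carrier where
  le := P.Le
  lt x y := P.Le x y ∧ ¬ P.Le y x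
  le_refl := h.refl
  le_trans := h.trans
  le_antisymm := h.antisymm
  le_total := h.total
  toDecidableLE := Classical.decRel _

theorem wordLt_toWord_iff_lt (h : IsLinearOrder P.Carrier P.Le) (x y : P.Carrier) :
    letI := P.linearOrder h
    P.wordLt (P.toWord x) (P.toWord y) ↔ x < y := by
  let _ := P.linearOrder h
  rw [wordLt_toWord]
  exact (lt_iff_le_and_ne (a := x) (b := y)).symm

theorem preimage_iterDeriv_domainSet (h : IsLinearOrder P.Carrier P.Le) (j : ℕ) :
    letI := P.linearOrder h
    P.toWord ⁻¹' iterDeriv P.wordLt P.domainSet j =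
      iterDeriv (· < ·) (Set.univ : Set P.Carrier) j := by
  let _ := P.linearOrder h
  have := preimage_iterDeriv (ltV := (· < ·)) P.toWord_injective (P.wordLt_toWord_iff_lt h)
    (D := P.domainSet) (fun b hb _ _ => P.range_toWord ▸ hb) j
  rw [this]
  congr 1
  exact Set.eq_univ_of_forall P.toWord_mem

theorem iterDeriv_subset_range (j : ℕ) :
    iterDeriv P.wordLt P.domainSet j ⊆ Set.range P.toWord :=
  P.range_toWord ▸ iterDeriv_subset _ _ j

theorem subsingleton_iterDeriv_iff (h : IsLinearOrder P.Carrier P.Le) (j : ℕ) :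
    letI := P.linearOrder h
    (iterDeriv (· < ·) (Set.univ : Set P.Carrier) j).Subsingleton ↔
      (iterDeriv P.wordLt P.domainSet j).Subsingleton := by
  let _ := P.linearOrder h
  rw [← P.preimage_iterDeriv_domainSet h]
  refine ⟨fun H => ?_, fun H => H.preimage P.toWord_injective⟩
  rw [← Set.image_preimage_eq_of_subset (P.iterDeriv_subset_range j)]
  exact H.image _

/-- Points `y < x` of level `J` would make the interval from `y` to `x` have size `ω ^ J`, beyond
what `not_isLarge_initial` allows below `x`. -/
theorem subsingleton_iterDeriv (h : IsLinearOrder P.Carrier P.Le)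
    (hwf : letI := P.linearOrder h; WellFoundedLT P.Carrier) {J : ℕ} (hJ : P.orderIndex < J) :
    (iterDeriv P.wordLt P.domainSet J).Subsingleton := by
  let _ := P.linearOrder h
  have := hwf
  rw [← P.subsingleton_iterDeriv_iff h]
  have key : ∀ x ∈ iterDeriv (· < ·) (Set.univ : Set P.Carrier) J,
      ∀ y ∈ iterDeriv (· < ·) (Set.univ : Set P.Carrier) J, ¬ y < x := by
    intro x hx y hy hyx
    have hl := (isLarge_Ico Set.univ J y hy x hx hyx).image (lt := P.wordLt) (φ := P.toWord)
      fun a _ b _ hab => (P.wordLt_toWord_iff_lt h a b).2 hab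
    have hmono : IsLarge P.wordLt J {z | z ∈ P.domainSet ∧ P.wordLt z (P.toWord x)} := by
      refine hl.mono ?_
      rintro _ ⟨z, hz, rfl⟩
      exact ⟨P.toWord_mem z, (P.wordLt_toWord_iff_lt h z x).2 hz.2⟩
    refine not_isLarge_initial P.finite_take_domainSet ?_ (fun _ _ hxx => hxx.2 rfl)
      ((P.hasIndex_domain 0).and (P.hasIndex_wordLt 0 1)) (P.hasIndex_wordLt 0 1)
      (P.toWord_mem x) (hmono.of_le ?_)
    · intro X hX hne
      have hne' : (P.toWord ⁻¹' X).Nonempty := by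
        obtain ⟨w, hw⟩ := hne
        obtain ⟨z, rfl⟩ : w ∈ Set.range P.toWord := P.range_toWord ▸ hX hw
        exact ⟨z, hw⟩
      obtain ⟨m, hm, hmin⟩ := WellFounded.has_min (wellFounded_lt (α := P.Carrier)) _ hne'
      refine ⟨_, hm, fun w hw hlt => ?_⟩
      obtain ⟨z, rfl⟩ : w ∈ Set.range P.toWord := P.range_toWord ▸ hX hw
      exact hmin z hw ((P.wordLt_toWord_iff_lt h z m).1 hlt)
    · refine Nat.succ_le_of_lt (lt_of_le_of_lt ?_ hJ)
      refine le_trans (le_of_eq ?_) (Nat.pow_le_pow_right P.baseIndex_pos (show 5 ≤ 6 by norm_num))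
      ring
  intro x hx y hy
  exact le_antisymm (not_lt.1 (key x hx y hy)) (not_lt.1 (key y hy x hx))

theorem isOrdinal_iff_wellFoundedLT (h : IsLinearOrder P.Carrier P.Le) :
    P.IsOrdinal ↔ (letI := P.linearOrder h; WellFoundedLT P.Carrier) := by
  let _ := P.linearOrder h
  have : (fun x y : P.Carrier => P.Le x y ∧ x ≠ y) = (· < ·) := by
    funext x y
    exact propext (lt_iff_le_and_ne (a := x) (b := y)).symm
  rw [IsOrdinal, this]
  exact ⟨fun H => ⟨H.2⟩, fun H => ⟨h, H.wf⟩⟩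

/-- Replaces well-foundedness by finitely many conditions that pumping can test. Only the forward
direction uses the rank bound. -/
theorem isOrdinal_iff {J : ℕ} (hJ : P.orderIndex < J) :
    P.IsOrdinal ↔ LinearOn P.wordLe (· ∈ P.domainSet) ∧
      (∀ j < J, DerivCofinite P.wordLt (iterDeriv P.wordLt P.domainSet j)) ∧
      (iterDeriv P.wordLt P.domainSet J).Subsingleton := by
  rw [← isLinearOrder_iff]
  by_cases h : IsLinearOrder P.Carrier P.Le
  swap
  · exact ⟨fun H => absurd H.1 h, fun H => absurd H.1 h⟩
  let _ := P.linearOrder h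
  rw [P.isOrdinal_iff_wellFoundedLT h, ← P.subsingleton_iterDeriv_iff h]
  have hcof : ∀ j, DerivCofinite P.wordLt (iterDeriv P.wordLt P.domainSet j) ↔
      DerivCofinite (· < ·) (iterDeriv (· < ·) (Set.univ : Set P.Carrier) j) := by
    intro j
    rw [← P.preimage_iterDeriv_domainSet h]
    exact (derivCofinite_preimage_iff P.toWord_injective (P.wordLt_toWord_iff_lt h)
      (P.iterDeriv_subset_range j)).symm
  simp only [hcof]
  constructor
  · intro hwf
    exact ⟨h, fun j _ => derivCofinite_of_wellFoundedLT _,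
      (P.subsingleton_iterDeriv_iff h J).2 (P.subsingleton_iterDeriv h hwf hJ)⟩
  · rintro ⟨-, h1, h2⟩
    exact wellFoundedLT_of_derivCofinite J h1 h2

theorem isomorphic_iff {P Q : AutomaticPresentation} {J : ℕ} (hP : P.IsOrdinal) (hQ : Q.IsOrdinal)
    (hPJ : P.orderIndex < J) (hQJ : Q.orderIndex < J) :
    P.Isomorphic Q ↔ (P.domainSet = ∅ ↔ Q.domainSet = ∅) ∧
      ∀ j < J, (derivTail P.wordLt (iterDeriv P.wordLt P.domainSet j)).encard =
        (derivTail Q.wordLt (iterDeriv Q.wordLt Q.domainSet j)).encard := by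
  let _ := P.linearOrder hP.1
  let _ := Q.linearOrder hQ.1
  have := (P.isOrdinal_iff_wellFoundedLT hP.1).1 hP
  have := (Q.isOrdinal_iff_wellFoundedLT hQ.1).1 hQ
  have key := nonempty_orderIso_iff (J := J)
    ((P.subsingleton_iterDeriv_iff hP.1 J).2 (P.subsingleton_iterDeriv hP.1 inferInstance hPJ))
    ((Q.subsingleton_iterDeriv_iff hQ.1 J).2 (Q.subsingleton_iterDeriv hQ.1 inferInstance hQJ))
  have htail : ∀ (P : AutomaticPresentation) (h : IsLinearOrder P.Carrier P.Le) (j : ℕ),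
      letI := P.linearOrder h
      (derivTail (· < ·) (iterDeriv (· < ·) (Set.univ : Set P.Carrier) j)).encard =
        (derivTail P.wordLt (iterDeriv P.wordLt P.domainSet j)).encard := by
    intro P h j
    let _ := P.linearOrder h
    rw [← P.preimage_iterDeriv_domainSet h, ← preimage_derivTail P.toWord_injective
      (P.wordLt_toWord_iff_lt h) (P.iterDeriv_subset_range j)]
    exact Set.encard_preimage_of_injective_subset_range P.toWord_injective
      (subset_trans (fun _ hx => hx.1) (P.iterDeriv_subset_range j))
  have hempty : ∀ P : AutomaticPresentation, Nonempty P.Carrier ↔ ¬ P.domainSet = ∅ := by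
    intro P
    rw [← P.range_toWord, Set.range_eq_empty_iff, not_isEmpty_iff]
  rw [hempty, hempty, not_iff_not] at key
  simp only [htail P hP.1, htail Q hQ.1] at key
  exact key

end AutomaticPresentation

/-! ### The decision procedure on lists of words -/

section Algorithm

theorem derivBound_iterate_le (n : ℕ) {i j : ℕ} (h : i ≤ j) :
    derivBound^[i] n ≤ derivBound^[j] n :=
  Function.monotone_iterate_of_id_le (f := derivBound) le_derivBound h n

/-- The words over `{0, …, k - 1}` of length at most `m`. -/
def wordList (k : ℕ) : ℕ → List (List ℕ)
  | 0 => [[]]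
  | m + 1 => [] :: (wordList k m).flatMap fun w => (List.range k).map fun a => a :: w

theorem mem_wordList {k m : ℕ} {w : List ℕ} :
    w ∈ wordList k m ↔ (∀ a ∈ w, a < k) ∧ w.length ≤ m := by
  induction m generalizing w with
  | zero => cases w <;> simp [wordList]
  | succ m ih =>
    cases w with
    | nil => simp [wordList]
    | cons a w => simp [wordList, ih]; tauto

theorem nodup_wordList (k m : ℕ) : (wordList k m).Nodup := by
  induction m with
  | zero => simp [wordList]
  | succ m ih =>
    refine List.nodup_cons.2 ⟨by simp, List.nodup_flatMap.2 ⟨fun w _ => ?_, ?_⟩⟩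
    · exact List.nodup_range.map fun a b h => (List.cons.inj h).1
    · refine ih.imp fun {u v} huv => ?_
      intro w hu hv
      simp only [List.mem_map] at hu hv
      obtain ⟨a, -, rfl⟩ := hu
      obtain ⟨b, -, h⟩ := hv
      exact huv (List.cons.inj h).2.symm

open Classical in
noncomputable def domainList (P : AutomaticPresentation) (M : ℕ) : List (List ℕ) :=
  (wordList P.alphabetSize M).filter fun w => w ∈ (P.domain.toNFA id).accepts

theorem listsUpTo_domainList (P : AutomaticPresentation) (M : ℕ) :
    ListsUpTo (domainList P M) P.domainSet M := by
  intro x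
  simp only [domainList, List.mem_filter, mem_wordList, decide_eq_true_eq]
  exact and_right_comm

/-- Approximations of the iterated derivatives of the presented order. -/
noncomputable def levelList (P : AutomaticPresentation) (N J : ℕ) : ℕ → List (List ℕ)
  | 0 => domainList P (3 * N * (J + 1))
  | j + 1 => derivList P.wordLt N (3 * N * (J - j)) (levelList P N J j)

theorem nodup_levelList (P : AutomaticPresentation) (N J j : ℕ) : (levelList P N J j).Nodup := by
  induction j with
  | zero => exact (nodup_wordList _ _).filter _
  | succ j ih => exact ih.filter _

variable {P Q : AutomaticPresentation} {n N J : ℕ}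

/-- Each derivative costs `3 * N` of the length up to which the list is exact, so a start at `3 * N
* (J + 1)` leaves `3 * N` at level `J`. One `N` serves all levels: it bounds the index of level `J`
after two further uses of `derivBound`. -/
theorem listsUpTo_levelList (hn : P.orderIndex ≤ n) (hN : derivBound^[J + 2] n ≤ N) {j : ℕ}
    (hj : j ≤ J + 1) :
    ListsUpTo (levelList P N J j) (iterDeriv P.wordLt P.domainSet j) (3 * N * (J + 1 - j)) := by
  induction j with
  | zero => exact listsUpTo_domainList P _
  | succ j ih =>
    have hle : derivBound (derivBound (derivBound^[j] n)) ≤ N := by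
      rw [← Function.iterate_succ_apply' derivBound, ← Function.iterate_succ_apply' derivBound]
      exact (derivBound_iterate_le n (by omega)).trans hN
    have h := ih (by omega)
    rw [show J + 1 - j = (J - j) + 1 by omega, mul_add, mul_one] at h
    rw [show J + 1 - (j + 1) = J - j by omega]
    exact h.derivList ((P.regularOrder hn).iterDeriv j) hle

def OrdinalCheck (P : AutomaticPresentation) (N J : ℕ) : Prop :=
  AutomaticPresentation.LinearOn P.wordLe (· ∈ levelList P N J 0) ∧
  (∀ j ∈ List.range J, CofiniteCheck P.wordLt N (3 * N * (J - j)) (levelList P N J j)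
    (levelList P N J (j + 1))) ∧
  ∀ x ∈ levelList P N J J, ∀ y ∈ levelList P N J J, x = y

noncomputable def levelCode (P : AutomaticPresentation) (N J j : ℕ) : ℕ :=
  sizeCode N (tailList P.wordLt N (levelList P N J j) (levelList P N J (j + 1)))

def SameCodes (P Q : AutomaticPresentation) (N J : ℕ) : Prop :=
  (levelList P N J 0 = [] ↔ levelList Q N J 0 = []) ∧
    ∀ j ∈ List.range J, levelCode P N J j = levelCode Q N J j

theorem isOrdinal_iff_check (hn : P.orderIndex ≤ n) (hN : derivBound^[J + 2] n ≤ N)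
    (hJ : n < J) : P.IsOrdinal ↔ OrdinalCheck P N J := by
  have hnN : ∀ j ≤ J + 2, derivBound^[j] n ≤ N := fun j hj =>
    (derivBound_iterate_le n hj).trans hN
  rw [P.isOrdinal_iff (hn.trans_lt hJ), OrdinalCheck]
  refine and_congr ?_ (and_congr ?_ ?_)
  · refine P.linearOn_iff (listsUpTo_levelList hn hN (Nat.zero_le _)) hn ?_
    refine (hnN 0 (by omega)).trans ?_
    rw [Nat.sub_zero]
    nlinarith [Nat.zero_le (N * J)]
  · simp only [List.mem_range]
    refine forall₂_congr fun j hj => ?_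
    have h := listsUpTo_levelList hn hN (show j ≤ J + 1 by omega)
    have h' := listsUpTo_levelList hn hN (show j + 1 ≤ J + 1 by omega)
    rw [show J + 1 - j = (J - j) + 1 by omega, mul_add, mul_one] at h
    rw [show J + 1 - (j + 1) = J - j by omega] at h'
    refine derivCofinite_iff h h' ((P.regularOrder hn).iterDeriv j) ?_ ?_
    · rw [← Function.iterate_succ_apply' derivBound, ← Function.iterate_succ_apply' derivBound]
      exact hnN _ (by omega)
    · have : 1 ≤ J - j := by omega
      nlinarith
  · have h := listsUpTo_levelList hn hN (show J ≤ J + 1 by omega)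
    constructor
    · exact fun H x hx y hy => H ((h x).1 hx).1 ((h y).1 hy).1
    · intro H x hx y hy
      -- If level `J` has two distinct points, it has two of length at most `N`, which are in the
      -- list.
      by_contra hne
      have hreg := (P.regularOrder hn).iterDeriv J
      have heq : HasIndex (derivBound^[J] n) fun x : Fin 3 → List ℕ => x 0 = x 1 :=
        (P.hasIndex_word_eq 0 1).mono (((Nat.le_self_pow (by norm_num) _).trans hn).trans
          (derivBound_iterate_le n (Nat.zero_le J)))
      have hi := (((hreg.mem 0).and ((hreg.mem 1).and heq.not)).mono
        (cube_le_derivBound _)).mono (M := N) (by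
          rw [← Function.iterate_succ_apply' derivBound]
          exact hnN (J + 1) (by omega))
      obtain ⟨w, ⟨a, b, c⟩, -, hl⟩ := hi.exists_short 0 ![x, y, []] ⟨hx, hy, hne⟩
      have hb : ∀ i, (w i).length ≤ 3 * N * (J + 1 - J) := by
        intro i
        have := hl i
        rw [show J + 1 - J = 1 by omega]
        omega
      exact c (H _ ((h _).2 ⟨a, hb 0⟩) _ ((h _).2 ⟨b, hb 1⟩))

theorem encard_derivTail_level (hn : P.orderIndex ≤ n) (hN : derivBound^[J + 2] n ≤ N) {j : ℕ}
    (hj : j < J) : (derivTail P.wordLt (iterDeriv P.wordLt P.domainSet j)).encard =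
      if levelCode P N J j = 0 then ⊤ else ((levelCode P N J j - 1 : ℕ) : ℕ∞) := by
  have h := listsUpTo_levelList hn hN (show j ≤ J + 1 by omega)
  have h' := listsUpTo_levelList hn hN (show j + 1 ≤ J + 1 by omega)
  rw [show J + 1 - j = (J - j) + 1 by omega, mul_add, mul_one] at h
  rw [show J + 1 - (j + 1) = J - j by omega] at h'
  refine encard_derivTail h h' (nodup_levelList P N J j) ((P.regularOrder hn).iterDeriv j) ?_ ?_
  · rw [← Function.iterate_succ_apply' derivBound, ← Function.iterate_succ_apply' derivBound]
    exact (derivBound_iterate_le n (by omega)).trans hN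
  · have : 1 ≤ J - j := by omega
    nlinarith

theorem domainSet_eq_empty_iff (hn : P.orderIndex ≤ n) (hN : derivBound^[J + 2] n ≤ N) :
    P.domainSet = ∅ ↔ levelList P N J 0 = [] := by
  have h := listsUpTo_levelList hn hN (Nat.zero_le (J + 1))
  rw [List.eq_nil_iff_forall_not_mem, Set.eq_empty_iff_forall_notMem]
  constructor
  · exact fun H x hx => H x ((h x).1 hx).1
  · intro H x hx
    have hi := ((P.regularOrder hn).mem 0).mono ((derivBound_iterate_le n (Nat.zero_le _)).trans hN)
    obtain ⟨w, a, -, hl⟩ := hi.exists_short 0 ![x, [], []] hx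
    refine H _ ((h _).2 ⟨a, ?_⟩)
    have := hl 0
    rw [Nat.sub_zero]
    nlinarith [Nat.zero_le (N * J)]

theorem isomorphic_iff_sameCodes (hP : P.IsOrdinal) (hQ : Q.IsOrdinal) (hPn : P.orderIndex ≤ n)
    (hQn : Q.orderIndex ≤ n) (hN : derivBound^[J + 2] n ≤ N) (hJ : n < J) :
    P.Isomorphic Q ↔ SameCodes P Q N J := by
  rw [AutomaticPresentation.isomorphic_iff hP hQ (hPn.trans_lt hJ) (hQn.trans_lt hJ), SameCodes,
    domainSet_eq_empty_iff hPn hN, domainSet_eq_empty_iff hQn hN]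
  refine and_congr_right fun _ => ?_
  simp only [List.mem_range]
  refine forall₂_congr fun j hj => ?_
  rw [encard_derivTail_level hPn hN hj, encard_derivTail_level hQn hN hj]
  generalize levelCode P N J j = a
  generalize levelCode Q N J j = b
  -- Code 0 stands for `⊤` and code `k + 1` for `k`, so equal sizes mean equal codes.
  cases a <;> cases b <;> simp

end Algorithm

/-! ### The procedure is primitive recursive -/

section PrimitiveRecursion

variable {γ β : Type} [Primcodable γ] [Primcodable β]

theorem PrimrecPred.imp {p q : γ → Prop} (hp : PrimrecPred p) (hq : PrimrecPred q) :
    PrimrecPred fun a => p a → q a :=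
  (hp.not.or hq).of_eq fun _ => imp_iff_not_or.symm

theorem PrimrecPred.iff {p q : γ → Prop} (hp : PrimrecPred p) (hq : PrimrecPred q) :
    PrimrecPred fun a => p a ↔ q a :=
  ((hp.imp hq).and (hq.imp hp)).of_eq fun _ => iff_def.symm

theorem PrimrecPred.forall_mem {f : γ → List β} {p : γ → β → Prop} (hf : Primrec f)
    (hp : PrimrecPred fun a : γ × β => p a.1 a.2) : PrimrecPred fun a => ∀ b ∈ f a, p a b :=
  (PrimrecRel.forall_mem_list (R := fun b a => p a b) (PrimrecRel.swap hp)).comp hf Primrec.id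

theorem PrimrecPred.exists_mem {f : γ → List β} {p : γ → β → Prop} (hf : Primrec f)
    (hp : PrimrecPred fun a : γ × β => p a.1 a.2) : PrimrecPred fun a => ∃ b ∈ f a, p a b :=
  (PrimrecRel.exists_mem_list (R := fun b a => p a b) (PrimrecRel.swap hp)).comp hf Primrec.id

theorem Primrec.filter {f : γ → List β} {p : γ → β → Prop} [∀ a, DecidablePred (p a)]
    (hf : Primrec f) (hp : PrimrecPred fun a : γ × β => p a.1 a.2) :
    Primrec fun a => (f a).filter (p a ·) :=
  (PrimrecRel.listFilter (R := fun b a => p a b) (PrimrecRel.swap hp)).comp hf Primrec.id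

theorem PrimrecPred.mem_list {f : γ → List β} {g : γ → β} (hf : Primrec f) (hg : Primrec g) :
    PrimrecPred fun a => g a ∈ f a :=
  (PrimrecPred.exists_mem hf (p := fun a b => b = g a)
    (Primrec.eq.comp Primrec.snd (hg.comp Primrec.fst))).of_eq fun a => by simp

theorem Primrec.nat_pow : Primrec₂ ((· ^ ·) : ℕ → ℕ → ℕ) :=
  Primrec₂.unpaired'.1 Nat.Primrec.pow

namespace WordAutomaton

theorem primrec_equivProd : Primrec (equivProd β) := Primrec.of_equiv

variable {A : γ → WordAutomaton β}

theorem primrec_numStates (hA : Primrec A) : Primrec fun a => (A a).numStates :=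
  Primrec.fst.comp (primrec_equivProd.comp hA)

theorem primrec_start (hA : Primrec A) : Primrec fun a => (A a).start :=
  Primrec.fst.comp (Primrec.snd.comp (primrec_equivProd.comp hA))

theorem primrec_trans (hA : Primrec A) : Primrec fun a => (A a).trans :=
  Primrec.fst.comp (Primrec.snd.comp (Primrec.snd.comp (primrec_equivProd.comp hA)))

theorem primrec_accept (hA : Primrec A) : Primrec fun a => (A a).accept :=
  Primrec.snd.comp (Primrec.snd.comp (Primrec.snd.comp (primrec_equivProd.comp hA)))

open Classical in
/-- The states reached from a state in `S` by reading `a`. -/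
noncomputable def stepList {σ : Type} (A : WordAutomaton σ) (S : List ℕ) (a : σ) : List ℕ :=
  (A.trans.filter fun t => t.1 ∈ S ∧ t.2.1 = a ∧ t.2.2 < A.numStates).map fun t => t.2.2

noncomputable def runList {σ : Type} (A : WordAutomaton σ) (w : List σ) : List ℕ :=
  w.foldl A.stepList (if A.start < A.numStates then [A.start] else [])

/-- Lists of numbers simulate sets of states; `hS` keeps stray numbers out of the list, where they
could fire transitions that the automaton ignores. -/
theorem mem_evalFrom_iff {σ : Type} (A : WordAutomaton σ) (w : List σ) (S : List ℕ)
    (S' : Set (Fin A.numStates)) (hS : ∀ q ∈ S, q < A.numStates)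
    (hSS' : ∀ q : Fin A.numStates, q ∈ S' ↔ (q : ℕ) ∈ S) (q : Fin A.numStates) :
    q ∈ (A.toNFA id).evalFrom S' w ↔ (q : ℕ) ∈ w.foldl A.stepList S := by
  induction w generalizing S S' with
  | nil => exact hSS' q
  | cons a w ih =>
    refine ih (A.stepList S a) _ ?_ ?_
    · intro r hr
      simp only [stepList, List.mem_map, List.mem_filter, decide_eq_true_eq] at hr
      obtain ⟨t, ⟨-, -, -, ht⟩, rfl⟩ := hr
      exact ht
    · intro r
      simp only [NFA.mem_stepSet, stepList, List.mem_map, List.mem_filter, decide_eq_true_eq]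
      constructor
      · rintro ⟨t, ht, h⟩
        exact ⟨(t, a, r), ⟨h, (hSS' t).1 ht, rfl, r.2⟩, rfl⟩
      · rintro ⟨⟨t, b, s⟩, ⟨h, ht, rfl, -⟩, rfl⟩
        exact ⟨⟨t, hS t ht⟩, (hSS' _).2 ht, h⟩

theorem mem_accepts_iff {σ : Type} (A : WordAutomaton σ) (w : List σ) :
    w ∈ (A.toNFA id).accepts ↔ ∃ q ∈ A.runList w, q < A.numStates ∧ q ∈ A.accept := by
  have key := A.mem_evalFrom_iff w (if A.start < A.numStates then [A.start] else [])
    (A.toNFA id).start (by split_ifs <;> simp [*]) (by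
      intro q
      split_ifs with h
      · simp [toNFA]
      · simp only [toNFA, Set.mem_ofPred_eq, List.not_mem_nil, iff_false]
        rintro h'
        exact h (h' ▸ q.2))
  rw [NFA.mem_accepts]
  constructor
  · rintro ⟨q, hq, hw⟩
    exact ⟨q, (key q).1 hw, q.2, hq⟩
  · rintro ⟨q, hw, hlt, hq⟩
    exact ⟨⟨q, hlt⟩, hq, (key ⟨q, hlt⟩).2 hw⟩

theorem primrecPred_accepts {f : γ → List β} (hA : Primrec A) (hf : Primrec f) :
    PrimrecPred fun a => f a ∈ ((A a).toNFA id).accepts := by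
  classical
  have hstep : Primrec fun x : γ × (List ℕ × β) => (A x.1).stepList x.2.1 x.2.2 := by
    refine Primrec.list_map (Primrec.filter (primrec_trans (hA.comp Primrec.fst)) ?_)
      (Primrec.snd.comp (Primrec.snd.comp Primrec.snd))
    exact (PrimrecPred.mem_list (Primrec.fst.comp (Primrec.snd.comp Primrec.fst))
        (Primrec.fst.comp Primrec.snd)).and
      ((Primrec.eq.comp (Primrec.fst.comp (Primrec.snd.comp Primrec.snd))
        (Primrec.snd.comp (Primrec.snd.comp Primrec.fst))).and
        (Primrec.nat_lt.comp (Primrec.snd.comp (Primrec.snd.comp Primrec.snd))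
          (primrec_numStates (hA.comp (Primrec.fst.comp Primrec.fst)))))
  have hrun : Primrec fun a => (A a).runList (f a) := by
    refine Primrec.list_foldl (h := fun a q => (A a).stepList q.1 q.2) hf (Primrec.ite
      (Primrec.nat_lt.comp (primrec_start hA) (primrec_numStates hA))
      (Primrec.list_cons.comp (primrec_start hA) (Primrec.const [])) (Primrec.const [])) hstep
  refine (PrimrecPred.exists_mem hrun
    (p := fun a q => q < (A a).numStates ∧ q ∈ (A a).accept) ?_).of_eq fun a =>
      ((A a).mem_accepts_iff (f a)).symm
  exact (Primrec.nat_lt.comp Primrec.snd (primrec_numStates (hA.comp Primrec.fst))).and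
    (PrimrecPred.mem_list (primrec_accept (hA.comp Primrec.fst)) Primrec.snd)

end WordAutomaton

/-- Lookup beyond the end returns `none`, which is the padding symbol. In this form primitive
recursiveness follows by composition. -/
theorem wordConvolution_eq_map_range {α : Type} (x y : List α) :
    wordConvolution x y =
      (List.range (max x.length y.length)).map fun i => (x[i]?, y[i]?) := by
  refine List.ext_getElem? fun i => ?_
  rw [wordConvolution, List.getElem?_zipWithAll, List.getElem?_map]
  by_cases h : i < max x.length y.length
  · have hxy : x[i]? ≠ none ∨ y[i]? ≠ none := by
      simpa using lt_max_iff.1 h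
    rw [List.getElem?_range h, Option.map_some]
    cases hx : x[i]? <;> cases hy : y[i]? <;> simp_all
  · rw [not_lt, max_le_iff] at h
    rw [List.getElem?_eq_none h.1, List.getElem?_eq_none h.2, List.getElem?_eq_none (by simpa using h)]
    rfl

theorem primrec_wordConvolution {f g : γ → List β} (hf : Primrec f) (hg : Primrec g) :
    Primrec fun a => wordConvolution (f a) (g a) := by
  refine Primrec.of_eq ?_ fun a => (wordConvolution_eq_map_range (f a) (g a)).symm
  exact Primrec.list_map (Primrec.list_range.comp
    (Primrec.nat_max.comp (Primrec.list_length.comp hf) (Primrec.list_length.comp hg)))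
    ((Primrec.list_getElem?.comp (hf.comp Primrec.fst) Primrec.snd).pair
      (Primrec.list_getElem?.comp (hg.comp Primrec.fst) Primrec.snd))

namespace AutomaticPresentation

theorem primrec_equivProd : Primrec equivProd := Primrec.of_equiv

variable {P : γ → AutomaticPresentation}

theorem primrec_alphabetSize (hP : Primrec P) : Primrec fun a => (P a).alphabetSize :=
  Primrec.fst.comp (primrec_equivProd.comp hP)

theorem primrec_domain (hP : Primrec P) : Primrec fun a => (P a).domain :=
  Primrec.fst.comp (Primrec.snd.comp (primrec_equivProd.comp hP))

theorem primrec_relation (hP : Primrec P) : Primrec fun a => (P a).relation :=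
  Primrec.snd.comp (Primrec.snd.comp (primrec_equivProd.comp hP))

theorem primrecPred_wordLe {x y : γ → List ℕ} (hP : Primrec P) (hx : Primrec x) (hy : Primrec y) :
    PrimrecPred fun a => (P a).wordLe (x a) (y a) :=
  WordAutomaton.primrecPred_accepts (primrec_relation hP) (primrec_wordConvolution hx hy)

theorem primrecPred_wordLt {x y : γ → List ℕ} (hP : Primrec P) (hx : Primrec x) (hy : Primrec y) :
    PrimrecPred fun a => (P a).wordLt (x a) (y a) :=
  (primrecPred_wordLe hP hx hy).and (Primrec.eq.comp hx hy).not

theorem primrec_orderIndex (hP : Primrec P) : Primrec fun a => (P a).orderIndex :=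
  Primrec.nat_pow.comp (Primrec.nat_mul.comp (Primrec.const 8)
    (Primrec.nat_pow.comp (Primrec.const 2) (Primrec.nat_add.comp
      (WordAutomaton.primrec_numStates (primrec_domain hP))
      (WordAutomaton.primrec_numStates (primrec_relation hP))))) (Primrec.const 6)

end AutomaticPresentation

open AutomaticPresentation

theorem primrec_derivBound : Primrec derivBound := by
  have hm : ∀ {f g : ℕ → ℕ}, Primrec f → Primrec g → Primrec fun n => f n * g n :=
    fun hf hg => Primrec.nat_mul.comp hf hg
  have hp : ∀ {f : ℕ → ℕ}, Primrec f → Primrec fun n => 2 ^ f n :=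
    fun hf => Primrec.nat_pow.comp (Primrec.const 2) hf
  have i : Primrec fun n : ℕ => n := Primrec.id
  exact hm i (hp (hm i (hm i (hp (hm i (hm i i))))))

theorem primrec_wordList : Primrec₂ wordList := by
  have : Primrec₂ fun (k m : ℕ) => (Nat.rec [[]] (fun _ V => [] :: V.flatMap fun w =>
      (List.range k).map fun a => a :: w) m : List (List ℕ)) := by
    refine Primrec.nat_rec (f := fun _ => [[]]) (g := fun k q => [] :: q.2.flatMap fun w =>
      (List.range k).map fun a => a :: w) (Primrec.const _) ?_
    refine Primrec.list_cons.comp (Primrec.const []) (Primrec.list_flatMap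
      (Primrec.snd.comp Primrec.snd) ?_)
    refine Primrec.list_map (Primrec.list_range.comp (Primrec.fst.comp Primrec.fst)) ?_
    exact Primrec.list_cons.comp Primrec.snd (Primrec.snd.comp Primrec.fst)
  refine this.of_eq fun k m => ?_
  induction m with
  | zero => rfl
  | succ m ih => simp only [wordList, ih]

variable {P Q : γ → AutomaticPresentation} {N J M B : γ → ℕ} {V V' : γ → List (List ℕ)}
  {x y : γ → List ℕ}

theorem primrec_domainList (hP : Primrec P) (hM : Primrec M) :
    Primrec fun a => domainList (P a) (M a) := by
  classical
  exact Primrec.filter (primrec_wordList.comp (primrec_alphabetSize hP) hM)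
    (WordAutomaton.primrecPred_accepts (primrec_domain (hP.comp Primrec.fst)) Primrec.snd)

theorem primrecPred_longBetween (hP : Primrec P) (hV : Primrec V) (hB : Primrec B)
    (hy : Primrec y) (hx : Primrec x) :
    PrimrecPred fun a => LongBetween (P a).wordLt (V a) (B a) (y a) (x a) :=
  PrimrecPred.exists_mem hV
    ((Primrec.nat_lt.comp (hB.comp Primrec.fst) (Primrec.list_length.comp Primrec.snd)).and
      ((primrecPred_wordLt (hP.comp Primrec.fst) (hy.comp Primrec.fst) Primrec.snd).and
        (primrecPred_wordLt (hP.comp Primrec.fst) Primrec.snd (hx.comp Primrec.fst))))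

theorem primrec_longBound (hN : Primrec N) (hM : Primrec M) : Primrec fun a => M a + 2 * N a :=
  Primrec.nat_add.comp hM (Primrec.nat_mul.comp (Primrec.const 2) hN)

theorem primrec_derivList (hP : Primrec P) (hN : Primrec N) (hM : Primrec M) (hV : Primrec V) :
    Primrec fun a => derivList (P a).wordLt (N a) (M a) (V a) := by
  classical
  have h1 : Primrec fun q : (γ × List ℕ) × List ℕ => q.1.1 := Primrec.fst.comp Primrec.fst
  have h2 : Primrec fun q : (γ × List ℕ) × List ℕ => q.1.2 := Primrec.snd.comp Primrec.fst
  refine Primrec.filter hV ((Primrec.nat_le.comp (Primrec.list_length.comp Primrec.snd)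
    (hM.comp Primrec.fst)).and (PrimrecPred.forall_mem (hV.comp Primrec.fst) ?_))
  exact (Primrec.nat_le.comp (Primrec.list_length.comp Primrec.snd)
    (Primrec.nat_add.comp (hM.comp h1) (hN.comp h1))).imp
    ((primrecPred_wordLt (hP.comp h1) Primrec.snd h2).imp
      (primrecPred_longBetween (hP.comp h1) (hV.comp h1)
        ((primrec_longBound hN hM).comp h1) Primrec.snd h2))

theorem primrecPred_cofiniteCheck (hP : Primrec P) (hN : Primrec N) (hM : Primrec M)
    (hV : Primrec V) (hV' : Primrec V') :
    PrimrecPred fun a => CofiniteCheck (P a).wordLt (N a) (M a) (V a) (V' a) := by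
  have h1 : Primrec fun q : (γ × List ℕ) × List ℕ => q.1.1 := Primrec.fst.comp Primrec.fst
  have h2 : Primrec fun q : (γ × List ℕ) × List ℕ => q.1.2 := Primrec.snd.comp Primrec.fst
  refine PrimrecPred.forall_mem hV ((Primrec.nat_le.comp (Primrec.list_length.comp Primrec.snd)
    (hN.comp Primrec.fst)).imp (PrimrecPred.exists_mem (hV'.comp Primrec.fst) ?_))
  exact (primrecPred_wordLt (hP.comp h1) h2 Primrec.snd).not.and
    (primrecPred_longBetween (hP.comp h1) (hV.comp h1)
      ((primrec_longBound hN hM).comp h1) Primrec.snd h2).not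

theorem primrec_tailList (hP : Primrec P) (hN : Primrec N) (hV : Primrec V) (hV' : Primrec V') :
    Primrec fun a => tailList (P a).wordLt (N a) (V a) (V' a) := by
  classical
  have h1 : Primrec fun q : (γ × List ℕ) × List ℕ => q.1.1 := Primrec.fst.comp Primrec.fst
  have h2 : Primrec fun q : (γ × List ℕ) × List ℕ => q.1.2 := Primrec.snd.comp Primrec.fst
  exact Primrec.filter hV ((Primrec.nat_le.comp (Primrec.list_length.comp Primrec.snd)
    (Primrec.nat_mul.comp (Primrec.const 2) (hN.comp Primrec.fst))).and
      (PrimrecPred.forall_mem (hV'.comp Primrec.fst)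
        (primrecPred_wordLt (hP.comp h1) Primrec.snd h2)))

theorem primrec_sizeCode (hN : Primrec N) (hV : Primrec V) :
    Primrec fun a => sizeCode (N a) (V a) := by
  classical
  exact Primrec.ite (PrimrecPred.exists_mem hV (Primrec.nat_lt.comp (hN.comp Primrec.fst)
    (Primrec.list_length.comp Primrec.snd))) (Primrec.const 0)
    (Primrec.succ.comp (Primrec.list_length.comp hV))

theorem primrec_levelBound (hN : Primrec N) (hJ : Primrec J) {j : γ → ℕ} (hj : Primrec j) :
    Primrec fun a => 3 * N a * (J a - j a) :=
  Primrec.nat_mul.comp (Primrec.nat_mul.comp (Primrec.const 3) hN) (Primrec.nat_sub.comp hJ hj)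

theorem primrec_levelList (hP : Primrec P) (hN : Primrec N) (hJ : Primrec J) {j : γ → ℕ}
    (hj : Primrec j) : Primrec fun a => levelList (P a) (N a) (J a) (j a) := by
  have : Primrec fun a => (Nat.rec (domainList (P a) (3 * N a * (J a + 1)))
      (fun i V => derivList (P a).wordLt (N a) (3 * N a * (J a - i)) V) (j a) :
        List (List ℕ)) := by
    have hfst : Primrec fun q : γ × (ℕ × List (List ℕ)) => q.1 := Primrec.fst
    refine Primrec.nat_rec' hj (primrec_domainList hP (Primrec.nat_mul.comp
      (Primrec.nat_mul.comp (Primrec.const 3) hN) (Primrec.succ.comp hJ)))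
      (h := fun a q => derivList (P a).wordLt (N a) (3 * N a * (J a - q.1)) q.2) ?_
    exact primrec_derivList (hP.comp hfst) (hN.comp hfst)
      (primrec_levelBound (hN.comp hfst) (hJ.comp hfst) (Primrec.fst.comp Primrec.snd))
      (Primrec.snd.comp Primrec.snd)
  refine this.of_eq fun a => ?_
  induction j a with
  | zero => rfl
  | succ i ih => simp only [levelList, ih]

theorem primrecPred_linearOn (hP : Primrec P) (hV : Primrec V) :
    PrimrecPred fun a => LinearOn (P a).wordLe (· ∈ V a) := by
  have h1 : Primrec fun q : (γ × List ℕ) × List ℕ => q.1.1 := Primrec.fst.comp Primrec.fst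
  have h2 : Primrec fun q : (γ × List ℕ) × List ℕ => q.1.2 := Primrec.snd.comp Primrec.fst
  have hV1 := hV.comp (Primrec.fst : Primrec fun q : γ × List ℕ => q.1)
  have k1 : Primrec fun q : ((γ × List ℕ) × List ℕ) × List ℕ => q.1.1.1 := h1.comp Primrec.fst
  have k2 : Primrec fun q : ((γ × List ℕ) × List ℕ) × List ℕ => q.1.1.2 := h2.comp Primrec.fst
  have k3 : Primrec fun q : ((γ × List ℕ) × List ℕ) × List ℕ => q.1.2 :=
    Primrec.snd.comp Primrec.fst
  refine PrimrecPred.and ?_ (PrimrecPred.and ?_ ?_)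
  · exact PrimrecPred.forall_mem hV (PrimrecPred.forall_mem hV1
      ((primrecPred_wordLe (hP.comp h1) h2 Primrec.snd).or
        (primrecPred_wordLe (hP.comp h1) Primrec.snd h2)))
  · exact PrimrecPred.forall_mem hV (PrimrecPred.forall_mem hV1
      ((primrecPred_wordLe (hP.comp h1) h2 Primrec.snd).imp
        ((primrecPred_wordLe (hP.comp h1) Primrec.snd h2).imp (Primrec.eq.comp h2 Primrec.snd))))
  · exact PrimrecPred.forall_mem hV (PrimrecPred.forall_mem hV1
      (PrimrecPred.forall_mem (hV.comp h1) ((primrecPred_wordLe (hP.comp k1) k2 k3).imp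
        ((primrecPred_wordLe (hP.comp k1) k3 Primrec.snd).imp
          (primrecPred_wordLe (hP.comp k1) k2 Primrec.snd)))))

theorem primrecPred_ordinalCheck (hP : Primrec P) (hN : Primrec N) (hJ : Primrec J) :
    PrimrecPred fun a => OrdinalCheck (P a) (N a) (J a) := by
  have hfst : Primrec fun q : γ × ℕ => q.1 := Primrec.fst
  have hsnd : Primrec fun q : γ × ℕ => q.2 := Primrec.snd
  have hP' := hP.comp hfst
  have hN' := hN.comp hfst
  have hJ' := hJ.comp hfst
  have htop := primrec_levelList hP hN hJ hJ
  refine PrimrecPred.and (primrecPred_linearOn hP (primrec_levelList hP hN hJ (Primrec.const 0)))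
    (PrimrecPred.and ?_ ?_)
  · exact PrimrecPred.forall_mem (Primrec.list_range.comp hJ)
      (primrecPred_cofiniteCheck hP' hN' (primrec_levelBound hN' hJ' hsnd)
        (primrec_levelList hP' hN' hJ' hsnd)
        (primrec_levelList hP' hN' hJ' (Primrec.succ.comp hsnd)))
  · exact PrimrecPred.forall_mem htop (PrimrecPred.forall_mem (htop.comp Primrec.fst)
      (Primrec.eq.comp (Primrec.snd.comp Primrec.fst) Primrec.snd))

theorem primrec_levelCode (hP : Primrec P) (hN : Primrec N) (hJ : Primrec J) {j : γ → ℕ}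
    (hj : Primrec j) : Primrec fun a => levelCode (P a) (N a) (J a) (j a) :=
  primrec_sizeCode hN (primrec_tailList hP hN (primrec_levelList hP hN hJ hj)
    (primrec_levelList hP hN hJ (Primrec.succ.comp hj)))

theorem primrecPred_sameCodes (hP : Primrec P) (hQ : Primrec Q) (hN : Primrec N)
    (hJ : Primrec J) : PrimrecPred fun a => SameCodes (P a) (Q a) (N a) (J a) := by
  have hfst : Primrec fun q : γ × ℕ => q.1 := Primrec.fst
  have hsnd : Primrec fun q : γ × ℕ => q.2 := Primrec.snd
  have hnil : ∀ {P : γ → AutomaticPresentation}, Primrec P →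
      PrimrecPred fun a => levelList (P a) (N a) (J a) 0 = [] := fun hP =>
    Primrec.eq.comp (primrec_levelList hP hN hJ (Primrec.const 0)) (Primrec.const [])
  exact ((hnil hP).iff (hnil hQ)).and (PrimrecPred.forall_mem (Primrec.list_range.comp hJ)
    (Primrec.eq.comp (primrec_levelCode (hP.comp hfst) (hN.comp hfst) (hJ.comp hfst) hsnd)
      (primrec_levelCode (hQ.comp hfst) (hN.comp hfst) (hJ.comp hfst) hsnd)))

end PrimitiveRecursion

theorem mainTheorem12 :
    ComputablePred fun p : AutomaticPresentation × AutomaticPresentation =>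
      p.1.IsOrdinal ∧ p.2.IsOrdinal ∧ p.1.Isomorphic p.2 := by
  -- Both presentations share `n`, `J = n + 1` and `N`, so that their codes can be compared level by
  -- level.
  let n : AutomaticPresentation × AutomaticPresentation → ℕ :=
    fun p => p.1.orderIndex + p.2.orderIndex
  let N : AutomaticPresentation × AutomaticPresentation → ℕ :=
    fun p => derivBound^[n p + 1 + 2] (n p)
  have hn : Primrec n := Primrec.nat_add.comp
    (AutomaticPresentation.primrec_orderIndex Primrec.fst)
    (AutomaticPresentation.primrec_orderIndex Primrec.snd)
  have hJ : Primrec fun p => n p + 1 := Primrec.succ.comp hn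
  have hN : Primrec N := Primrec.nat_iterate (Primrec.succ.comp (Primrec.succ.comp hJ)) hn
    (primrec_derivBound.comp Primrec.snd)
  refine PrimrecPred.computablePred (((primrecPred_ordinalCheck Primrec.fst hN hJ).and
    ((primrecPred_ordinalCheck Primrec.snd hN hJ).and
      (primrecPred_sameCodes Primrec.fst Primrec.snd hN hJ))).of_eq fun p => ?_)
  have h1 : p.1.orderIndex ≤ n p := Nat.le_add_right _ _
  have h2 : p.2.orderIndex ≤ n p := Nat.le_add_left _ _
  rw [← isOrdinal_iff_check h1 le_rfl (Nat.lt_succ_self _),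
    ← isOrdinal_iff_check h2 le_rfl (Nat.lt_succ_self _)]
  -- Equality of codes expresses isomorphism only for ordinals, so both ordinal conditions are
  -- assumed first.
  refine and_congr_right fun hP => and_congr_right fun hQ => ?_
  exact (isomorphic_iff_sameCodes hP hQ h1 h2 le_rfl (Nat.lt_succ_self _)).symm
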